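/- Let $L\ge 2$. For a nonempty finite set $M$ of $m$ candidates, identified with $\{0,\dots,m-1\}$, an up-to-$L$ vote is a strict ranking of $i$ distinct candidates of $M$ with $1\le i\le L$ (the remaining candidates being tied below them), a profile is a finite sequence of such votes, and an up-to-$L$ voting rule $\overline r_L$ assigns to every such $M$ and every profile over $M$ a unique winner in $M$. It is anonymous if the winner does not change when the votes of a profile are permuted. The problem WAV-$\overline r_L$ (winner with absent votes) asks, given $M$, a profile $P$ of known votes, a number $t\ge 0$ of absent votes and a candidate $c\in M$, whether there is a profile $P'$ of $t$ up-to-$L$ votes such that $\overline r_L(P\cup P')=c$, where $P\cup P'$ is the concatenation of the two profiles. Inputs are encoded so that $M$ and $t$ contribute $m$ and $t$ symbols (that is, $m$ and $t$ are written in unary) and profiles are listed vote by vote. Let $\overline r_L$ be an anonymous up-to-$L$ voting rule whose winner can be computed in polynomial time, given $M$ and a profile over $M$. Then 1. for every fixed $m\ge 2$, the problem WAV-$\overline r_L$ restricted to instances with exactly $m$ candidates (where $m$ is a constant and not part of the input) can be solved in polynomial time; 2. for every fixed $t\ge 0$, the problem WAV-$\overline r_L$ restricted to instances with exactly $t$ absent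 votes (where $t$ is a constant and not part of the input) can be solved in polynomial time. -/

import Mathlib

namespace UpToL

open Turing Computability

/-- A vote in the up-to-`L` setting over the candidates `Fin m`: a strict ranking of `i` distinct
candidates, best first, with `1 ≤ i ≤ L`; the unranked candidates are tied below the ranked ones. -/
@[ext]
structure Ballot (m L : ℕ) where
  ranking : List (Fin m)
  nodup : ranking.Nodup
  one_le_length : 1 ≤ ranking.length
  length_le : ranking.length ≤ L

/-- A profile is a finite sequence of votes, one for each voter. -/
abbrev Profile (m L : ℕ) : Type := List (Ballot m L)

/-- A resolute up-to-`L` voting rule: for every nonempty finite set of candidates, it maps every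
profile to a unique winner. -/
def VotingRule (L : ℕ) : Type := ∀ m : ℕ, 0 < m → Profile m L → Fin m

/-- The winner does not depend on which voter cast which vote. -/
def VotingRule.Anonymous {L : ℕ} (r : VotingRule L) : Prop :=
  ∀ (m : ℕ) (hm : 0 < m) (P Q : Profile m L), P.Perm Q → r m hm P = r m hm Q

/-- An input of the winner determination problem: a nonempty set of candidates and a profile. -/
structure Election (L : ℕ) where
  m : ℕ
  pos : 0 < m
  votes : Profile m L

/-- The number of the winning candidate. -/
def VotingRule.winner {L : ℕ} (r : VotingRule L) (E : Election L) : ℕ :=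
  (r E.m E.pos E.votes : ℕ)

/-- An input of the problem WAV (winner with absent votes). -/
structure WAVInstance (L : ℕ) where
  /-- the number of candidates -/
  m : ℕ
  /-- the profile of known votes -/
  known : Profile m L
  /-- the number of absent votes -/
  absent : ℕ
  /-- the targeted candidate -/
  target : Fin m

/-- The question of WAV: is there a profile of absent votes, of the prescribed size, that makes the
targeted candidate the winner? -/
def VotingRule.WAV {L : ℕ} (r : VotingRule L) (I : WAVInstance L) : Prop :=
  ∃ P' : Profile I.m L, P'.length = I.absent ∧
    r I.m I.target.pos (I.known ++ P') = I.target

/-! ### Encodings as strings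

The set of candidates and the number of absent votes contribute `m` and `t` symbols to the input,
and the profile is written vote by vote. Since the set of candidates takes up `m` symbols anyway,
writing a candidate as a tally instead of in binary changes lengths only polynomially. -/

/-- A natural number as a tally, closed by a comma. -/
def encodeTally (k : ℕ) : List Γ' := List.replicate k (Γ'.bit true) ++ [Γ'.comma]

/-- A vote: the ranked candidates in order, between brackets. -/
def encodeBallot {m L : ℕ} (v : Ballot m L) : List Γ' :=
  Γ'.bra :: v.ranking.flatMap (fun c : Fin m => encodeTally c.val) ++ [Γ'.ket]

def encodeProfile {m L : ℕ} (P : Profile m L) : List Γ' := P.flatMap encodeBallot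

def encodeElection {L : ℕ} (E : Election L) : List Γ' :=
  encodeTally E.m ++ encodeProfile E.votes

/-- Inputs of WAV with a fixed number `m` of candidates; `m` is not part of the input string. -/
def encodeFixedM {L m : ℕ} (I : {I : WAVInstance L // I.m = m}) : List Γ' :=
  encodeTally I.1.absent ++ encodeTally (I.1.target : ℕ) ++ encodeProfile I.1.known

/-- Inputs of WAV with a fixed number `t` of absent votes; `t` is not part of the input string. -/
def encodeFixedT {L t : ℕ} (I : {I : WAVInstance L // I.absent = t}) : List Γ' :=
  encodeTally I.1.m ++ encodeTally (I.1.target : ℕ) ++ encodeProfile I.1.known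

/-! ### Polynomial time -/

/-- Some Turing machine decides, for every input `a`, whether `p a` holds, in a number of steps
that is at most a polynomial in the length of the string that encodes `a`. -/
def PolyTimeDecidable {α Γ : Type} (enc : α → List Γ) (p : α → Prop) : Prop :=
  ∃ f : α → Bool, (∀ a, f a = true ↔ p a) ∧
    Nonempty (TM2ComputableInPolyTime enc encodeBool f)

/-- The winner can be computed in polynomial time from the candidates and the profile. -/
def VotingRule.PolyTime {L : ℕ} (r : VotingRule L) : Prop :=
  Nonempty (TM2ComputableInPolyTime (encodeElection (L := L)) encodeTally r.winner)

end UpToL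

/-! ### A structured language of stack programs with calls to a fixed machine -/

/-! Both claims hold by exhaustive search with one call of the winner machine per candidate
solution; what must be seen is that the number of candidate solutions is polynomial. For fixed `m`
there are finitely many ballots, and by anonymity only the number of occurrences of each ballot
among the absent votes matters. These counts lie between 0 and `t`, so at most `(t + 1) ^ b` vectors
of counts need testing, where `b`, the number of ballots, is constant; since `t` is written in
unary, this is polynomial. For fixed `t` the lengths of the absent votes can be chosen in `L ^ t`
ways, and then at most `t * L` candidates have to be named, which leaves at most `m ^ (t * L)`
choices.

Both searches have the same shape: a fixed finite set of counters runs through all values below a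
bound read from the input, and a test is made for each assignment. `polyTimeDecidable_exists` states
this once; `wav_fixed_m` and `wav_fixed_t` supply the counters and the test, which is a validity
check followed by a call of the winner machine (`runsIn_guarded`).

Since polynomial time refers to actual Turing machines, the search is written in a small language of
stack programs with a big-step semantics that counts steps. `Exec.steps` compiles such a program,
step for step, into a machine that contains the given winner machine, and
`polyTimeDecidable_of_runsIn` turns a time bound for the program into polynomial-time decidability.
-/

namespace StackProg

open Turing Computability Function StateTransition

/-- Programs over stacks indexed by `ι`. Conditions inspect the top symbol of a stack; `call i o`
runs a fixed machine on the reversal of stack `i` and puts the output, reversed, on stack `o`. -/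
inductive Prog (ι : Type) : Type
  | skip : Prog ι
  | push (k : ι) (a : Γ') : Prog ι
  | pop (k : ι) : Prog ι
  | copyTop (k k' : ι) : Prog ι
  | seq (p q : Prog ι) : Prog ι
  | ite (k : ι) (c : Option Γ' → Bool) (p q : Prog ι) : Prog ι
  | while (k : ι) (c : Option Γ' → Bool) (p : Prog ι) : Prog ι
  | call (i o : ι) : Prog ι

/-- The contents of the stacks, top first. -/
abbrev Store (ι : Type) : Type := ι → List Γ'

variable {ι : Type} [DecidableEq ι]

/-- The machine `O` turns the input `w` into the output `u` in exactly `n` steps. -/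
def Answers (O : TM2ComputableAux Γ' Γ') (w u : List Γ') (n : ℕ) : Prop :=
  (flip bind O.tm.step)^[n] (some (initList O.tm (w.map O.inputAlphabet.invFun))) =
    some (haltList O.tm (u.map O.outputAlphabet.invFun))

/-- `Exec O p S n S'`: the program `p` takes the store `S` to the store `S'` in `n` steps, when
calls are answered by the machine `O`. -/
inductive Exec (O : TM2ComputableAux Γ' Γ') : Prog ι → Store ι → ℕ → Store ι → Prop
  | skip (S) : Exec O .skip S 1 S
  | push (k a S) : Exec O (.push k a) S 1 (update S k (a :: S k))
  | pop (k S) : Exec O (.pop k) S 1 (update S k (S k).tail)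
  | copyTop (k k' S a l) (h : S k = a :: l) :
      Exec O (.copyTop k k') S 1 (update S k' (a :: S k'))
  | seq {p q S n S' n' S''} (h : Exec O p S n S') (h' : Exec O q S' n' S'') :
      Exec O (.seq p q) S (n + n') S''
  | ite_true {k c p q S n S'} (hc : c (S k).head? = true) (h : Exec O p S n S') :
      Exec O (.ite k c p q) S (1 + n) S'
  | ite_false {k c p q S n S'} (hc : c (S k).head? = false) (h : Exec O q S n S') :
      Exec O (.ite k c p q) S (1 + n) S'
  | while_true {k c p S n S' n' S''} (hc : c (S k).head? = true) (h : Exec O p S n S')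
      (h' : Exec O (.while k c p) S' n' S'') : Exec O (.while k c p) S (1 + n + n') S''
  | while_false {k c p S} (hc : c (S k).head? = false) : Exec O (.while k c p) S 1 S
  | call {i o S w u n} (hi : S i = w.reverse) (h : Answers O w u n) :
      Exec O (.call i o) S (w.length + 1 + n + (u.length + 1))
        (update (update S i []) o (u.reverse ++ update S i [] o))

/-! ### Compilation of stack programs into multi-stack Turing machines -/

section Compile

variable (O : TM2ComputableAux Γ' Γ') {Λ : Type}

/-- The stacks of the compiled machine: an output stack, the stacks of the program and the stacks
of the called machine. -/
abbrev Stack (ι : Type) : Type := Option ι ⊕ O.tm.K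

/-- The stack alphabets of the compiled machine. -/
@[reducible] def Alphabet : Stack O ι → Type
  | .inl none => Bool
  | .inl (some _) => Γ'
  | .inr k => O.tm.Γ k

/-- The internal states of the compiled machine: a register and a state of the called machine. -/
abbrev Register : Type := Option Γ' × O.tm.σ

/-- The labels of a compiled program. -/
def Label : Prog ι → Type
  | .skip => Unit
  | .push _ _ => Unit
  | .pop _ => Unit
  | .copyTop _ _ => Unit
  | .seq p q => Label p ⊕ Label q
  | .ite _ _ p q => Option (Label p ⊕ Label q)
  | .while _ _ p => Option (Label p)
  | .call _ _ => Bool ⊕ O.tm.Λ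

@[reducible] def labelFintype : (p : Prog ι) → Fintype (Label O p)
  | .skip => inferInstanceAs (Fintype Unit)
  | .push _ _ => inferInstanceAs (Fintype Unit)
  | .pop _ => inferInstanceAs (Fintype Unit)
  | .copyTop _ _ => inferInstanceAs (Fintype Unit)
  | .seq p q =>
    letI := labelFintype p
    letI := labelFintype q
    inferInstanceAs (Fintype (Label O p ⊕ Label O q))
  | .ite _ _ p q =>
    letI := labelFintype p
    letI := labelFintype q
    inferInstanceAs (Fintype (Option (Label O p ⊕ Label O q)))
  | .while _ _ p =>
    letI := labelFintype p
    inferInstanceAs (Fintype (Option (Label O p)))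
  | .call _ _ =>
    letI := O.tm.ΛFin
    inferInstanceAs (Fintype (Bool ⊕ O.tm.Λ))

/-- The label at which the execution of a program starts. -/
def entry : (p : Prog ι) → Label O p
  | .skip => ()
  | .push _ _ => ()
  | .pop _ => ()
  | .copyTop _ _ => ()
  | .seq p _ => .inl (entry p)
  | .ite _ _ _ _ => none
  | .while _ _ _ => none
  | .call _ _ => .inl false

variable {O}

/-- A statement of the called machine as a statement of the compiled machine. -/
def liftStmt (e : O.tm.Λ → Λ) (exit : Λ) :
    TM2.Stmt O.tm.Γ O.tm.Λ O.tm.σ → TM2.Stmt (Alphabet (ι := ι) O) Λ (Register O)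
  | .push k f q => .push (.inr k) (fun s => f s.2) (liftStmt e exit q)
  | .peek k f q => .peek (.inr k) (fun s a => (s.1, f s.2 a)) (liftStmt e exit q)
  | .pop k f q => .pop (.inr k) (fun s a => (s.1, f s.2 a)) (liftStmt e exit q)
  | .load f q => .load (fun s => (s.1, f s.2)) (liftStmt e exit q)
  | .branch f q q' => .branch (fun s => f s.2) (liftStmt e exit q) (liftStmt e exit q')
  | .goto f => .goto (fun s => e (f s.2))
  | .halt => .goto (fun _ => exit)

/-- Clear the register and jump. -/
def jump (l : Λ) : TM2.Stmt (Alphabet (ι := ι) O) Λ (Register O) :=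
  .load (fun s => (none, s.2)) (.goto fun _ => l)

/-- Jump according to the top symbol of a program stack. -/
def test (k : ι) (c : Option Γ' → Bool) (l₁ l₂ : Λ) :
    TM2.Stmt (Alphabet (ι := ι) O) Λ (Register O) :=
  .peek (.inl (some k)) (fun s a => (a, s.2)) (.branch (fun s => c s.1) (jump l₁) (jump l₂))

/-- The code of a program whose labels are placed by `e` and which continues at `exit`. -/
def code : (p : Prog ι) → (Label O p → Λ) → Λ → Label O p →
    TM2.Stmt (Alphabet (ι := ι) O) Λ (Register O)
  | .skip, _, exit, _ => jump exit
  | .push k a, _, exit, _ => .push (.inl (some k)) (fun _ => a) (jump exit)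
  | .pop k, _, exit, _ => .pop (.inl (some k)) (fun s _ => s) (jump exit)
  | .copyTop k k', _, exit, _ =>
    .peek (.inl (some k)) (fun s a => (a, s.2))
      (.push (.inl (some k')) (fun s => (s.1.getD default : Γ')) (jump exit))
  | .seq p q, e, exit, l =>
    Sum.rec (code p (fun l => e (.inl l)) (e (.inr (entry O q))))
      (code q (fun l => e (.inr l)) exit) l
  | .ite k c p q, e, exit, l =>
    Option.rec (test k c (e (some (.inl (entry O p)))) (e (some (.inr (entry O q)))))
      (fun l => Sum.rec (code p (fun l => e (some (.inl l))) exit)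
        (code q (fun l => e (some (.inr l))) exit) l) l
  | .while k c p, e, exit, l =>
    Option.rec (test k c (e (some (entry O p))) exit)
      (code p (fun l => e (some l)) (e none)) l
  | .call i o, e, exit, l =>
    Sum.rec
      (fun b => Bool.rec
        (.pop (.inl (some i)) (fun s a => (a, s.2))
          (.branch (fun s => s.1.isSome)
            (.push (.inr O.tm.k₀) (fun s => O.inputAlphabet.invFun (s.1.getD default))
              (jump (e (.inl false))))
            (jump (e (.inr O.tm.main)))))
        (.pop (.inr O.tm.k₁) (fun s a => (a.map O.outputAlphabet, s.2))
          (.branch (fun s => s.1.isSome)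
            (.push (.inl (some o)) (fun s => (s.1.getD default : Γ'))
              (jump (e (.inl true))))
            (jump exit))) b)
      (fun l => liftStmt (fun l => e (.inr l)) (e (.inl true)) (O.tm.m l)) l

/-- The stacks of the compiled machine. -/
def glue (b : List Bool) (S : Store ι) (T : ∀ k, List (O.tm.Γ k)) :
    ∀ k : Stack O ι, List (Alphabet O k)
  | .inl none => b
  | .inl (some k) => S k
  | .inr k => T k

theorem update_glue_some (b : List Bool) (S : Store ι) (T : ∀ k, List (O.tm.Γ k)) (k : ι)
    (x : List Γ') :
    update (glue b S T) (.inl (some k)) x = glue b (update S k x) T := by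
  funext j
  rcases j with (_ | j) | j
  · rfl
  · by_cases h : j = k
    · subst h; simp [glue]
    · have : (Sum.inl (some j) : Stack O ι) ≠ Sum.inl (some k) := by simpa using h
      rw [update_of_ne this]
      simp [glue, h]
  · rfl

theorem update_glue_inr (b : List Bool) (S : Store ι) (T : ∀ k, List (O.tm.Γ k)) (k : O.tm.K)
    (x : List (O.tm.Γ k)) :
    update (glue b S T) (.inr k) x = glue b S (update T k x) := by
  funext j
  rcases j with (_ | j) | j
  · rfl
  · rfl
  · by_cases h : j = k
    · subst h; simp [glue]
    · have : (Sum.inr j : Stack O ι) ≠ Sum.inr k := by simpa using h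
      rw [update_of_ne this]
      simp [glue, h]

/-- The configuration of the compiled machine in which the called machine is idle. -/
def idleCfg (l : Λ) (S : Store ι) : TM2.Cfg (Alphabet (ι := ι) O) Λ (Register O) :=
  ⟨some l, (none, O.tm.initialState), glue [] S fun _ => []⟩

/-- A configuration of the called machine as one of the compiled machine. -/
def liftCfg (e : O.tm.Λ → Λ) (exit : Λ) (S : Store ι) (c : O.tm.Cfg) :
    TM2.Cfg (Alphabet (ι := ι) O) Λ (Register O) :=
  ⟨some (c.l.elim exit e), (none, c.var), glue [] S c.stk⟩

/-- Lifted statements never touch the register or the program stacks, and `halt` becomes a jump to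
`exit`, which is how `liftCfg` represents a halted configuration. -/
theorem stepAux_liftStmt (e : O.tm.Λ → Λ) (exit : Λ) (S : Store ι)
    (q : TM2.Stmt O.tm.Γ O.tm.Λ O.tm.σ) (v : O.tm.σ) (T : ∀ k, List (O.tm.Γ k)) :
    TM2.stepAux (liftStmt e exit q) (none, v) (glue [] S T) =
      liftCfg e exit S (TM2.stepAux q v T) := by
  induction q generalizing v T with
  | push k f q ih =>
    rw [liftStmt, TM2.stepAux.eq_1, TM2.stepAux.eq_1, ← ih]
    exact congrArg _ (update_glue_inr _ _ _ _ _)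
  | peek k f q ih =>
    rw [liftStmt, TM2.stepAux, TM2.stepAux, ← ih]
    rfl
  | pop k f q ih =>
    rw [liftStmt, TM2.stepAux, TM2.stepAux, ← ih]
    exact congrArg _ (update_glue_inr _ _ _ _ _)
  | load f q ih =>
    rw [liftStmt, TM2.stepAux, TM2.stepAux, ← ih]
  | branch f q q' ih ih' =>
    rw [liftStmt, TM2.stepAux, TM2.stepAux, ih, ih']
    cases f v <;> rfl
  | goto f => rfl
  | halt => rfl

/-- The configuration `c'` comes `n` steps after `c`. -/
def Steps {C : Type} (f : C → Option C) (n : ℕ) (c c' : C) : Prop :=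
  (flip bind f)^[n] (some c) = some c'

theorem Steps.single {C : Type} {f : C → Option C} {c c' : C} (h : f c = some c') :
    Steps f 1 c c' := h

theorem Steps.trans {C : Type} {f : C → Option C} {n n' : ℕ} {c c' c'' : C}
    (h : Steps f n c c') (h' : Steps f n' c' c'') : Steps f (n + n') c c'' := by
  unfold Steps at *
  rw [add_comm, iterate_add_apply, h, h']

/-- A run that reaches a configuration cannot have passed through `none`, because `none` is
absorbing for `flip bind f`. -/
theorem Steps.head {C : Type} {f : C → Option C} {n : ℕ} {c c'' : C}
    (h : Steps f (n + 1) c c'') : ∃ c', f c = some c' ∧ Steps f n c' c'' := by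
  unfold Steps at *
  rw [iterate_succ_apply] at h
  change (flip bind f)^[n] (f c) = some c'' at h
  cases hc : f c with
  | none =>
    rw [hc] at h
    have : (flip bind f)^[n] (none : Option C) = none := by
      clear h
      induction n with
      | zero => rfl
      | succ n ih => rw [iterate_succ_apply]; exact ih
    rw [this] at h
    cases h
  | some c' => exact ⟨c', rfl, hc ▸ h⟩

variable {M : Λ → TM2.Stmt (Alphabet (ι := ι) O) Λ (Register O)}

/-- Simulation without overhead: the step in which the called machine halts is the step in which the
compiled machine jumps to `exit`. -/
theorem steps_liftCfg {e : O.tm.Λ → Λ} {exit : Λ} (S : Store ι)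
    (hM : ∀ l, M (e l) = liftStmt e exit (O.tm.m l)) {n : ℕ} {c c' : O.tm.Cfg}
    (h : Steps O.tm.step n c c') :
    Steps (TM2.step M) n (liftCfg e exit S c) (liftCfg e exit S c') := by
  induction n generalizing c with
  | zero => cases h; rfl
  | succ n ih =>
    obtain ⟨d, hd, h⟩ := h.head
    rw [add_comm]
    refine Steps.trans (Steps.single ?_) (ih h)
    obtain ⟨_ | l, v, T⟩ := c
    · cases hd
    · cases hd
      change some (TM2.stepAux (M (e l)) _ _) = _
      rw [hM]
      exact congrArg some (stepAux_liftStmt e exit S _ v T)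

theorem step_jump {l l' : Λ} {S : Store ι} (h : M l = jump l') :
    TM2.step M (idleCfg l S) = some (idleCfg l' S) := by
  simp only [idleCfg, TM2.step, h, jump, TM2.stepAux]

theorem step_test {k : ι} {c : Option Γ' → Bool} {l l₁ l₂ : Λ} {S : Store ι}
    (h : M l = test k c l₁ l₂) :
    TM2.step M (idleCfg l S) = some (idleCfg (if c (S k).head? then l₁ else l₂) S) := by
  simp only [idleCfg, TM2.step, h, test, jump, TM2.stepAux]
  change some (cond (c (S k).head?) _ _) = _
  cases c (S k).head? <;> rfl

/-- Each pass of the loop is one machine step that moves one symbol, and one more step detects the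
empty stack. The transfer reverses the word, which is why a call takes its input reversed. The part
`T` already transferred is kept general for the induction. -/
theorem steps_load {i o : ι} {e : Label O (Prog.call i o) → Λ} {exit : Λ}
    (hM : ∀ l, M (e l) = code (Prog.call i o) e exit l) (w : List Γ') (S : Store ι)
    (T : List (O.tm.Γ O.tm.k₀)) (hS : S i = w) :
    Steps (TM2.step M) (w.length + 1)
      ⟨some (e (.inl false)), (none, O.tm.initialState), glue [] S (update (fun _ => []) _ T)⟩
      ⟨some (e (.inr O.tm.main)), (none, O.tm.initialState),
        glue [] (update S i [])
          (update (fun _ => []) _ (w.reverse.map O.inputAlphabet.invFun ++ T))⟩ := by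
  induction w generalizing S T with
  | nil =>
    refine Steps.single ?_
    refine (congrArg (fun q => some (TM2.stepAux q _ _)) (hM (.inl false))).trans ?_
    change some (cond (S i).head?.isSome _ _) = _
    erw [update_glue_some]
    change some (cond (S i).head?.isSome _ (TM2.Cfg.mk _ _ (glue [] (update S i (S i).tail) _))) = _
    simp [hS]
  | cons a w ih =>
    rw [List.length_cons, add_comm]
    refine Steps.trans (Steps.single ?_)
      (c' := ⟨some (e (.inl false)), (none, O.tm.initialState),
        glue [] (update S i w) (update (fun _ => []) _ (O.inputAlphabet.invFun a :: T))⟩) ?_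
    · refine (congrArg (fun q => some (TM2.stepAux q _ _)) (hM (.inl false))).trans ?_
      change some (cond (S i).head?.isSome _ _) = _
      erw [update_glue_some]
      change some (cond (S i).head?.isSome (TM2.Cfg.mk _ _
        (update (glue [] (update S i (S i).tail) _) (.inr O.tm.k₀)
          (O.inputAlphabet.invFun ((S i).head?.getD default) ::
            update (fun _ => []) O.tm.k₀ T O.tm.k₀))) _) = _
      rw [update_glue_inr]
      simp [hS]
    · have := ih (update S i w) (O.inputAlphabet.invFun a :: T) (by simp)
      simpa using this

theorem steps_unload {i o : ι} {e : Label O (Prog.call i o) → Λ} {exit : Λ}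
    (hM : ∀ l, M (e l) = code (Prog.call i o) e exit l) (u : List Γ') (S : Store ι) :
    Steps (TM2.step M) (u.length + 1)
      ⟨some (e (.inl true)), (none, O.tm.initialState),
        glue [] S (update (fun _ => []) _ (u.map O.outputAlphabet.invFun))⟩
      (idleCfg exit (update S o (u.reverse ++ S o))) := by
  induction u generalizing S with
  | nil =>
    refine Steps.single ?_
    refine (congrArg (fun q => some (TM2.stepAux q _ _)) (hM (.inl true))).trans ?_
    change some (cond (Option.map O.outputAlphabet
      (update (fun _ => []) O.tm.k₁ _ O.tm.k₁ : List _).head?).isSome _ _) = _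
    erw [update_glue_inr]
    change some (cond _ _ (TM2.Cfg.mk _ _ (glue [] S (update (update (fun _ => []) O.tm.k₁ _) _
      ((update (fun _ => []) O.tm.k₁ _ O.tm.k₁ : List _).tail))))) = _
    simp [idleCfg]
  | cons a u ih =>
    rw [List.length_cons, add_comm]
    refine Steps.trans (Steps.single ?_)
      (c' := ⟨some (e (.inl true)), (none, O.tm.initialState),
        glue [] (update S o (a :: S o))
          (update (fun _ => []) _ (u.map O.outputAlphabet.invFun))⟩) ?_
    · refine (congrArg (fun q => some (TM2.stepAux q _ _)) (hM (.inl true))).trans ?_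
      change some (cond (Option.map O.outputAlphabet
        (update (fun _ => []) O.tm.k₁ _ O.tm.k₁ : List _).head?).isSome _ _) = _
      erw [update_glue_inr]
      change some (cond _ (TM2.Cfg.mk _ _ (update (glue [] S
        (update (update (fun _ => []) O.tm.k₁ _) _
          ((update (fun _ => []) O.tm.k₁ _ O.tm.k₁ : List _).tail))) (.inl (some o))
        ((Option.map O.outputAlphabet
          (update (fun _ => []) O.tm.k₁ _ O.tm.k₁ : List _).head?).getD default :: S o))) _) = _
      rw [update_glue_some]
      simp
    · have := ih (update S o (a :: S o))
      simpa using this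

theorem initList_eq (tm : FinTM2) (s : List (tm.Γ tm.k₀)) :
    initList tm s = ⟨some tm.main, tm.initialState, update (fun _ => []) _ s⟩ := by
  unfold initList
  congr 1
  funext k
  by_cases h : k = tm.k₀
  · subst h; simp
  · simp [h]

theorem haltList_eq (tm : FinTM2) (s : List (tm.Γ tm.k₁)) :
    haltList tm s = ⟨none, tm.initialState, update (fun _ => []) _ s⟩ := by
  unfold haltList
  congr 1
  funext k
  by_cases h : k = tm.k₁
  · subst h; simp
  · simp [h]

/-- The compiled program does what the program does, in the same time. -/
theorem Exec.steps {p : Prog ι} {S S' : Store ι} {n : ℕ} (h : Exec O p S n S')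
    {e : Label O p → Λ} {exit : Λ} (hM : ∀ l, M (e l) = code p e exit l) :
    Steps (TM2.step M) n (idleCfg (e (entry O p)) S) (idleCfg exit S') := by
  induction h generalizing exit with
  | skip S => exact Steps.single (step_jump (hM _))
  | push k a S =>
    refine Steps.single ?_
    simp only [idleCfg, TM2.step, hM, code, jump, TM2.stepAux]
    erw [update_glue_some]
    rfl
  | pop k S =>
    refine Steps.single ?_
    simp only [idleCfg, TM2.step, hM, code, jump, TM2.stepAux]
    erw [update_glue_some]
    rfl
  | copyTop k k' S a l h =>
    refine Steps.single ?_
    simp only [idleCfg, TM2.step, hM, code, jump, TM2.stepAux]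
    erw [update_glue_some]
    change some (TM2.Cfg.mk _ _ (glue [] (update S k' ((S k).head?.getD default :: S k')) _)) = _
    rw [h]
    rfl
  | seq h h' ih ih' =>
    exact (ih (e := fun l => e (.inl l)) (fun l => hM (.inl l))).trans
      (ih' (e := fun l => e (.inr l)) (fun l => hM (.inr l)))
  | @ite_true k c p q S n S' hc h ih =>
    have h1 := Steps.single (step_test (M := M) (S := S) (hM none))
    rw [if_pos hc] at h1
    exact h1.trans (ih (e := fun l => e (some (.inl l))) (fun l => hM (some (.inl l))))
  | @ite_false k c p q S n S' hc h ih =>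
    have h1 := Steps.single (step_test (M := M) (S := S) (hM none))
    rw [if_neg (by simp [hc])] at h1
    exact h1.trans (ih (e := fun l => e (some (.inr l))) (fun l => hM (some (.inr l))))
  | @while_true k c p S n S' n' S'' hc h h' ih ih' =>
    have h1 := Steps.single (step_test (M := M) (S := S) (hM none))
    rw [if_pos hc] at h1
    exact (h1.trans (ih (e := fun l => e (some l)) (fun l => hM (some l)))).trans (ih' hM)
  | @while_false k c p S hc =>
    have h1 := Steps.single (step_test (M := M) (S := S) (hM none))
    rw [if_neg (by simp [hc])] at h1
    exact h1
  | @call i o S w u n hi h =>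
    -- A call consists of loading, simulation and unloading. By definition `haltList` has the
    -- initial state and only the output stack filled, so the called machine is idle again after
    -- unloading and can be called any number of times.
    have h1 := steps_load hM w.reverse S [] hi
    have h2 := steps_liftCfg (update S i []) (fun l => hM (.inr l)) h
    have h3 := steps_unload hM u (update S i [])
    rw [initList_eq, haltList_eq] at h2
    simp only [List.length_reverse, List.reverse_reverse, List.append_nil] at h1
    rw [show (update (fun _ => []) O.tm.k₀ [] : ∀ k, List (O.tm.Γ k)) = fun _ => [] from
      update_eq_self _ _] at h1
    exact (h1.trans h2).trans h3

end Compile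

/-! ### The machine of a decision program -/

/-- The machine that runs `p` on the stack `inp` and answers whether the stack `flag` is nonempty
at the end. -/
def machine [Fintype ι] (O : TM2ComputableAux Γ' Γ') (p : Prog ι) (inp flag : ι) : FinTM2 :=
  letI := O.tm.kFin
  letI := O.tm.σFin
  letI := labelFintype O p
  { K := Stack O ι
    k₀ := .inl (some inp)
    k₁ := .inl none
    Γ := Alphabet O
    Λ := Option (Label O p)
    main := some (entry O p)
    σ := Register O
    initialState := (none, O.tm.initialState)
    Γk₀Fin := inferInstanceAs (Fintype Γ')
    m := fun l => Option.rec
      (.pop (.inl (some flag)) (fun s a => (a, s.2))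
        (.push (.inl none) (fun s => s.1.isSome) (.load (fun s => (none, s.2)) .halt)))
      (code p some none) l }

/-- The symbol of tallies. -/
abbrev one : Γ' := Γ'.bit true

/-- The program `p` takes `S` to `S'` in at most `T` steps. -/
def RunsIn (O : TM2ComputableAux Γ' Γ') (p : Prog ι) (S S' : Store ι) (T : ℕ) : Prop :=
  ∃ n ≤ T, Exec O p S n S'

/-- The program must leave every stack except `flag` empty, because a machine may only halt with
nothing but its output on the stacks. -/
theorem polyTimeDecidable_of_runsIn [Fintype ι] {α : Type} {enc : α → List Γ'} {P : α → Prop}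
    {O : TM2ComputableAux Γ' Γ'} {p : Prog ι} {inp flag : ι} (T : Polynomial ℕ)
    [DecidablePred P]
    (h : ∀ a, RunsIn O p (update (fun _ => []) inp (enc a))
      (update (fun _ => []) flag (if P a then [one] else [])) (T.eval (enc a).length)) :
    UpToL.PolyTimeDecidable enc P := by
  refine ⟨fun a => decide (P a), by simp, ⟨?_⟩⟩
  refine
    { tm := machine O p inp flag
      inputAlphabet := Equiv.refl _
      outputAlphabet := Equiv.refl _
      -- One extra step pops the flag, writes the answer and halts.
      time := T + 1
      outputsFun := fun a => ?_ }
  choose n hn hex using h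
  have hs := (hex a).steps (M := (machine O p inp flag).m) (e := some) (exit := none)
    (fun _ => rfl)
  set F : List Γ' := if P a then [one] else [] with hF
  have hstk : (update (update (glue (O := O) [] (update (fun _ => []) flag F) fun _ => [])
      (Sum.inl (some flag)) (update (fun _ => []) flag F flag : List Γ').tail) (Sum.inl none)
      [(update (fun _ => []) flag F flag : List Γ').head?.isSome] :
      ∀ k : Stack O ι, List (Alphabet O k)) =
        @update (Stack O ι) (fun k => List (Alphabet O k)) _ (fun _ => []) (.inl none)
          [decide (P a)] := by
    rw [update_glue_some]
    funext k
    rcases k with (_ | k) | k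
    · change [(update (fun _ => []) flag F flag : List Γ').head?.isSome] = [_]
      by_cases hP : P a <;> simp [hF, hP]
    · change update (update (fun _ => []) flag F) flag
        (update (fun _ => []) flag F flag).tail k = []
      by_cases hP : P a <;> simp [hF, hP]
    · rfl
  have hs' : Steps (machine O p inp flag).step 1
      (idleCfg none (update (fun _ => []) flag F))
      (haltList (machine O p inp flag) [decide (P a)]) :=
    Steps.single ((congrArg (fun s => some (TM2.Cfg.mk none (none, O.tm.initialState) s))
      hstk).trans (congrArg some (haltList_eq (machine O p inp flag) [decide (P a)]).symm))
  have hinit : @update (Stack O ι) (fun k => List (Alphabet O k)) _ (fun _ => [])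
      (.inl (some inp)) (enc a) =
      glue [] (update (fun _ => []) inp (enc a)) fun _ => [] := by
    rw [← update_glue_some]
    congr 1
    funext k
    rcases k with (_ | k) | k <;> rfl
  have hi : initList (machine O p inp flag) (enc a) =
      idleCfg (some (entry O p)) (update (fun _ => []) inp (enc a)) :=
    (initList_eq (machine O p inp flag) (enc a)).trans
      (congrArg (TM2.Cfg.mk (some (some (entry O p))) (none, O.tm.initialState)) hinit)
  refine ⟨⟨n a + 1, ?_⟩, ?_⟩
  · have e1 : List.map (Equiv.refl Γ').invFun (enc a) = enc a := List.map_id _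
    refine (congrArg (fun w => (flip bind (machine O p inp flag).step)^[n a + 1]
      (some (initList (machine O p inp flag) w))) e1).trans ?_
    exact (congrArg (fun c => (flip bind (machine O p inp flag).step)^[n a + 1] (some c))
      hi).trans (hs.trans hs')
  · simpa using hn a

/-! ### Running times -/

section RunsIn

variable {O : TM2ComputableAux Γ' Γ'} {p q : Prog ι} {S S' S'' : Store ι} {T T' : ℕ}

theorem RunsIn.mono (h : RunsIn O p S S' T) (hT : T ≤ T') : RunsIn O p S S' T' :=
  let ⟨n, hn, h⟩ := h; ⟨n, hn.trans hT, h⟩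

theorem runsIn_skip : RunsIn O .skip S S 1 := ⟨1, le_rfl, .skip S⟩

theorem runsIn_push (k : ι) (a : Γ') : RunsIn O (.push k a) S (update S k (a :: S k)) 1 :=
  ⟨1, le_rfl, .push k a S⟩

theorem runsIn_pop (k : ι) : RunsIn O (.pop k) S (update S k (S k).tail) 1 :=
  ⟨1, le_rfl, .pop k S⟩

theorem runsIn_copyTop {k : ι} (k' : ι) {a : Γ'} {l : List Γ'} (h : S k = a :: l) :
    RunsIn O (.copyTop k k') S (update S k' (a :: S k')) 1 :=
  ⟨1, le_rfl, .copyTop k k' S a l h⟩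

theorem RunsIn.seq (h : RunsIn O p S S' T) (h' : RunsIn O q S' S'' T') :
    RunsIn O (.seq p q) S S'' (T + T') :=
  let ⟨_, hn, h⟩ := h; let ⟨_, hn', h'⟩ := h'; ⟨_, add_le_add hn hn', .seq h h'⟩

theorem RunsIn.ite_true {k : ι} {c : Option Γ' → Bool} (hc : c (S k).head? = true)
    (h : RunsIn O p S S' T) : RunsIn O (.ite k c p q) S S' (1 + T) :=
  let ⟨_, hn, h⟩ := h; ⟨_, add_le_add le_rfl hn, .ite_true hc h⟩

theorem RunsIn.ite_false {k : ι} {c : Option Γ' → Bool} (hc : c (S k).head? = false)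
    (h : RunsIn O q S S' T) : RunsIn O (.ite k c p q) S S' (1 + T) :=
  let ⟨_, hn, h⟩ := h; ⟨_, add_le_add le_rfl hn, .ite_false hc h⟩

theorem RunsIn.while_true {k : ι} {c : Option Γ' → Bool} (hc : c (S k).head? = true)
    (h : RunsIn O p S S' T) (h' : RunsIn O (.while k c p) S' S'' T') :
    RunsIn O (.while k c p) S S'' (1 + T + T') :=
  let ⟨_, hn, h⟩ := h; let ⟨_, hn', h'⟩ := h'
  ⟨_, add_le_add (add_le_add le_rfl hn) hn', .while_true hc h h'⟩

theorem runsIn_while_false {k : ι} {c : Option Γ' → Bool} (hc : c (S k).head? = false) :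
    RunsIn O (.while k c p) S S 1 := ⟨1, le_rfl, .while_false hc⟩

/-- A loop with a given number of iterations. -/
theorem runsIn_while {k : ι} {c : Option Γ' → Bool} (N : ℕ) (R : ℕ → Store ι)
    (hc : ∀ i < N, c (R i k).head? = true) (hN : c (R N k).head? = false)
    (h : ∀ i < N, RunsIn O p (R i) (R (i + 1)) T) :
    RunsIn O (.while k c p) (R 0) (R N) (N * (1 + T) + 1) := by
  induction N generalizing R with
  | zero => exact (runsIn_while_false hN).mono (by simp)
  | succ N ih =>
    have := ih (fun i => R (i + 1)) (fun i hi => hc _ (by omega)) hN (fun i hi => h _ (by omega))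
    exact (RunsIn.while_true (hc 0 (by omega)) (h 0 (by omega)) this).mono (by
      rw [Nat.succ_mul]; omega)

end RunsIn

/-! ### Basic programs -/

/-- Push a word, first symbol first. -/
def pushAll (k : ι) : List Γ' → Prog ι
  | [] => .skip
  | a :: l => .seq (.push k a) (pushAll k l)

/-- Move the symbols of a stack, as long as `c` holds for the top, to another one. -/
def moveWhile (c : Option Γ' → Bool) (k v : ι) : Prog ι :=
  .while k c (.seq (.copyTop k v) (.pop k))

/-- Empty a stack. -/
def clear (k : ι) : Prog ι := .while k Option.isSome (.pop k)

/-- Run `p` for every symbol of the stack `k`, using `tmp` to restore the stack. -/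
def forEach (k tmp : ι) (p : Prog ι) : Prog ι :=
  .seq (.while k Option.isSome (.seq p (.seq (.copyTop k tmp) (.pop k))))
    (moveWhile Option.isSome tmp k)

/-- Put the reversal of stack `k` on stack `v`. -/
def copy (k v tmp : ι) : Prog ι := forEach k tmp (.copyTop k v)

/-- Push a tally of the difference of the heights of two stacks, and empty them. -/
def diff (k k' e : ι) : Prog ι :=
  .seq (.while k Option.isSome (.seq (.pop k) (.ite k' Option.isSome (.pop k') (.push e one))))
    (.while k' Option.isSome (.seq (.pop k') (.push e one)))

/-! ### Correctness and running times of the basic programs -/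

section Basic

variable {O : TM2ComputableAux Γ' Γ'}

theorem runsIn_pushAll (k : ι) (l : List Γ') (S : Store ι) :
    RunsIn O (pushAll k l) S (update S k (l.reverse ++ S k)) (l.length + 1) := by
  induction l generalizing S with
  | nil => simpa [pushAll] using (runsIn_skip : RunsIn O .skip S S 1)
  | cons a l ih =>
    have := (runsIn_push k a).seq (ih (update S k (a :: S k)))
    simp only [update_self, update_idem] at this
    simp only [List.reverse_cons, List.append_assoc, List.singleton_append]
    exact this.mono (by simp; omega)

theorem runsIn_moveWhile {c : Option Γ' → Bool} {k k' : ι} (hk : k ≠ k') (l r : List Γ')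
    (hl : ∀ a ∈ l, c (some a) = true) (hr : c r.head? = false) (S : Store ι)
    (hS : S k = l ++ r) :
    RunsIn O (moveWhile c k k') S (update (update S k r) k' (l.reverse ++ S k'))
      (3 * l.length + 1) := by
  induction l generalizing S with
  | nil =>
    have : update (update S k r) k' ([].reverse ++ S k') = S := by
      simp only [List.nil_append] at hS
      rw [← hS]; simp
    rw [this]
    exact runsIn_while_false (by simpa [hS] using hr)
  | cons a l ih =>
    have h1 := (runsIn_copyTop (O := O) k' (S := S) hS).seq (runsIn_pop k)
    have h2 := ih (fun b hb => hl b (by simp [hb])) _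
      (show update (update S k' (a :: S k')) k (update S k' (a :: S k') k).tail k = l ++ r by
        simp [hk, hS])
    have h3 := RunsIn.while_true (k := k) (c := c) (by simp [hS, hl]) h1 h2
    refine Eq.subst (motive := fun S' => RunsIn O _ S S' _) ?_ (h3.mono (by simp; omega))
    funext j
    by_cases h : j = k'
    · subst h; simp [hk.symm]
    · by_cases h' : j = k
      · subst h'; simp [hk]
      · simp [h, h']

theorem runsIn_clear (k : ι) (S : Store ι) :
    RunsIn O (clear k) S (update S k []) (2 * (S k).length + 1) := by
  have := runsIn_while (O := O) (p := .pop k) (k := k) (c := Option.isSome) (T := 1) (S k).length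
    (fun i => update S k ((S k).drop i)) (fun i hi => by simp [hi]) (by simp)
    (fun i _ => by
      have := runsIn_pop (O := O) (S := update S k ((S k).drop i)) k
      simpa using this)
  simp only [List.drop_zero, update_eq_self, List.drop_length] at this
  exact this.mono (by omega)

/-- The body may read the current top of `k` but changes only `v`, so the symbols parked on `tmp`
survive and are moved back at the end. Both transfers reverse, hence `k` is restored in its original
order. -/
theorem runsIn_forEach {k tmp v : ι} (hkt : k ≠ tmp) (hkv : k ≠ v) (htv : tmp ≠ v) {p : Prog ι}
    {g : Γ' → List Γ'} {T : ℕ}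
    (hp : ∀ S a l, S k = a :: l → RunsIn O p S (update S v (g a ++ S v)) T) (S : Store ι)
    (ht : S tmp = []) :
    RunsIn O (forEach k tmp p) S (update S v ((S k).reverse.flatMap g ++ S v))
      ((S k).length * (T + 6) + 2) := by
  -- The first loop alone, with arbitrary contents of `tmp` and `v` so that the induction goes
  -- through.
  have key : ∀ (l : List Γ') (S : Store ι), S k = l →
      RunsIn O (.while k Option.isSome (.seq p (.seq (.copyTop k tmp) (.pop k)))) S
        (update (update (update S k []) tmp (l.reverse ++ S tmp)) v (l.reverse.flatMap g ++ S v))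
        (l.length * (T + 3) + 1) := by
    intro l
    induction l with
    | nil =>
      intro S hS
      have : update (update (update S k []) tmp ([].reverse ++ S tmp)) v
          ([].reverse.flatMap g ++ S v) = S := by
        have := update_eq_self k S
        rw [hS] at this
        simp [this]
      rw [this]
      exact (runsIn_while_false (by simp [hS])).mono (by simp)
    | cons a l ih =>
      intro S hS
      have h1 := hp S a l hS
      have h2 := runsIn_copyTop (O := O) (S := update S v (g a ++ S v)) tmp
        (show update S v (g a ++ S v) k = a :: l by simp [hkv, hS])
      have h3 := h1.seq (h2.seq (runsIn_pop k))
      have h4 := RunsIn.while_true (k := k) (c := Option.isSome) (by simp [hS]) h3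
        (ih _ (by simp [hkv, hkt, hS]))
      refine Eq.subst (motive := fun S' => RunsIn O _ S S' _) ?_ (h4.mono (by
        simp only [List.length_cons, Nat.succ_mul]; omega))
      funext j
      by_cases h : j = v
      · subst h; simp [hkv.symm, htv.symm]
      · by_cases h' : j = tmp
        · subst h'; simp [hkt.symm, htv]
        · by_cases h'' : j = k
          · subst h''; simp [h, h']
          · simp [h, h', h'']
  have h1 := key _ S rfl
  have h2 := runsIn_moveWhile (O := O) (c := Option.isSome) hkt.symm (S k).reverse []
    (by simp) (by simp) _ (show (update (update (update S k []) tmp ((S k).reverse ++ S tmp)) v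
      ((S k).reverse.flatMap g ++ S v)) tmp = _ by simp [ht, htv])
  refine Eq.subst (motive := fun S' => RunsIn O _ S S' _) ?_ ((h1.seq h2).mono (by
    simp only [List.length_reverse]; ring_nf; omega))
  funext j
  by_cases h : j = v
  · subst h; simp [hkv.symm, htv.symm]
  · by_cases h' : j = k
    · subst h'; simp [hkt, h]
    · by_cases h'' : j = tmp
      · subst h''; simp [h, h', ht]
      · simp [h, h', h'']

theorem runsIn_copy {k v tmp : ι} (hkt : k ≠ tmp) (hkv : k ≠ v) (htv : tmp ≠ v) (S : Store ι)
    (ht : S tmp = []) :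
    RunsIn O (copy k v tmp) S (update S v ((S k).reverse ++ S v)) (7 * (S k).length + 2) := by
  have := runsIn_forEach (O := O) hkt hkv htv (p := .copyTop k v) (g := fun a => [a]) (T := 1)
    (fun S a l h => by simpa using runsIn_copyTop v h) S ht
  simp only [List.flatMap_singleton'] at this
  exact this.mono (by omega)

theorem runsIn_forEach_pushAll {k v tmp : ι} (hkt : k ≠ tmp) (hkv : k ≠ v) (htv : tmp ≠ v)
    (w : List Γ') (S : Store ι) (ht : S tmp = []) :
    RunsIn O (forEach k tmp (pushAll v w)) S
      (update S v ((List.replicate (S k).length w).flatten.reverse ++ S v))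
      ((S k).length * (w.length + 7) + 2) := by
  have := runsIn_forEach (O := O) hkt hkv htv (p := pushAll v w) (g := fun _ => w.reverse)
    (fun S a l h => runsIn_pushAll v w S) S ht
  have e : (S k).reverse.flatMap (fun _ => w.reverse) =
      (List.replicate (S k).length w).flatten.reverse := by
    rw [List.reverse_flatten, List.map_replicate, List.reverse_replicate, List.flatMap,
      List.map_const', List.length_reverse]
  rw [e] at this
  exact this.mono (by rw [add_assoc])

/-- One of the two truncated differences is zero, so the tally is the absolute difference of the
heights; in particular it is empty exactly when the heights agree. This is the equality test of all
later programs. -/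
theorem runsIn_diff {k k' e : ι} (hk : k ≠ k') (hke : k ≠ e) (hke' : k' ≠ e) (S : Store ι) :
    RunsIn O (diff k k' e) S
      (update (update (update S k []) k' []) e (List.replicate
        ((S k).length - (S k').length + ((S k').length - (S k).length)) one ++ S e))
      (4 * (S k).length + 3 * (S k').length + 2) := by
  -- The first loop pops both stacks together; once `k'` is exhausted, each further symbol of `k` is
  -- recorded on `e`. The second loop records what is left of `k'`.
  have h1 := runsIn_while (O := O) (k := k) (c := Option.isSome)
    (p := .seq (.pop k) (.ite k' Option.isSome (.pop k') (.push e one))) (T := 3) (S k).length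
    (fun i => update (update (update S k ((S k).drop i)) k' ((S k').drop i)) e
      (List.replicate (i - (S k').length) one ++ S e))
    (fun i hi => by simp [hk, hke, hi]) (by simp [hk, hke]) (fun i hi => by
      refine ((runsIn_pop k).seq (T' := 2) ?_)
      by_cases h : i < (S k').length
      · have := RunsIn.ite_true (O := O) (k := k') (c := Option.isSome) (p := .pop k')
          (q := .push e one) (S := update (update (update (update S k ((S k).drop i)) k'
            ((S k').drop i)) e (List.replicate (i - (S k').length) one ++ S e)) k
            ((S k).drop (i + 1))) (by simp [hke', hk.symm, h]) (runsIn_pop k')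
        convert this using 1
        · simp [hk, hke]
        · funext j
          have e1 : i - (S k').length = 0 := by omega
          have e2 : i + 1 - (S k').length = 0 := by omega
          by_cases he : j = e
          · subst he; simp [e1, e2, hke.symm, hke'.symm]
          · by_cases h' : j = k'
            · subst h'; simp [he, hk.symm]
            · by_cases h'' : j = k
              · subst h''; simp [he, h']
              · simp [he, h', h'']
      · have := RunsIn.ite_false (O := O) (k := k') (c := Option.isSome) (p := .pop k')
          (q := .push e one) (S := update (update (update (update S k ((S k).drop i)) k'
            ((S k').drop i)) e (List.replicate (i - (S k').length) one ++ S e)) k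
            ((S k).drop (i + 1))) (by simp [hke', hk.symm]; omega) (runsIn_push e one)
        convert this using 1
        · simp [hk, hke]
        · funext j
          have e1 : i + 1 - (S k').length = i - (S k').length + 1 := by omega
          by_cases he : j = e
          · subst he; simp [e1, hke.symm, List.replicate_succ]
          · by_cases h' : j = k'
            · subst h'; simp only [ne_eq, he, hk.symm, not_false_eq_true, update_of_ne, update_self]
              rw [List.drop_eq_nil_of_le (by omega), List.drop_eq_nil_of_le (by omega)]
            · by_cases h'' : j = k
              · subst h''; simp [he, h']
              · simp [he, h', h''])
  have h2 := runsIn_while (O := O) (k := k') (c := Option.isSome)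
    (p := .seq (.pop k') (.push e one)) (T := 2) ((S k').length - (S k).length)
    (fun i => update (update (update S k []) k' (((S k').drop (S k).length).drop i)) e
      (List.replicate ((S k).length - (S k').length + i) one ++ S e))
    (fun i hi => by simp [hke']; omega) (by simp [hke']; omega) (fun i hi => by
      have := (runsIn_pop (O := O) (S := update (update (update S k []) k'
        (((S k').drop (S k).length).drop i)) e
        (List.replicate ((S k).length - (S k').length + i) one ++ S e)) k').seq
          (runsIn_push e one)
      convert this using 1
      funext j
      by_cases h : j = e
      · subst h; simp [hke'.symm, ← add_assoc, List.replicate_succ]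
      · by_cases h' : j = k'
        · subst h'; simp [h, add_assoc]
        · simp [h, h'])
  simp only [Nat.zero_sub, List.drop_zero, List.replicate_zero, List.nil_append, update_eq_self,
    List.drop_length, Nat.add_zero] at h1 h2
  refine Eq.subst (motive := fun S' => RunsIn O _ S S' _) ?_ ((h1.seq h2).mono (by omega))
  congr 2
  rw [List.drop_eq_nil_of_le]
  simp

end Basic

/-! ### Polynomial bounds -/

/-- The quantity `f` is bounded by a polynomial in `size`. -/
def PolyBound {α : Type} (size f : α → ℕ) : Prop := ∃ T : Polynomial ℕ, ∀ a, f a ≤ T.eval (size a)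

section PolyBound

variable {α : Type} {size f g : α → ℕ}

theorem PolyBound.mono (hg : PolyBound size g) (h : ∀ a, f a ≤ g a) : PolyBound size f :=
  let ⟨T, hT⟩ := hg; ⟨T, fun a => (h a).trans (hT a)⟩

theorem PolyBound.self : PolyBound size size := ⟨.X, by simp⟩

theorem PolyBound.of_le (h : ∀ a, f a ≤ size a) : PolyBound size f := PolyBound.self.mono h

theorem PolyBound.const (c : ℕ) : PolyBound size fun _ => c := ⟨.C c, by simp⟩

theorem PolyBound.add (hf : PolyBound size f) (hg : PolyBound size g) :
    PolyBound size fun a => f a + g a :=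
  let ⟨T, hT⟩ := hf; let ⟨U, hU⟩ := hg; ⟨T + U, fun a => by simpa using add_le_add (hT a) (hU a)⟩

theorem PolyBound.mul (hf : PolyBound size f) (hg : PolyBound size g) :
    PolyBound size fun a => f a * g a :=
  let ⟨T, hT⟩ := hf; let ⟨U, hU⟩ := hg; ⟨T * U, fun a => by simpa using mul_le_mul' (hT a) (hU a)⟩

/-- Coefficients in `ℕ` are nonnegative; this monotonicity is what allows time bounds to be
composed. -/
theorem eval_mono_nat (T : Polynomial ℕ) : Monotone fun n => T.eval n := by
  intro m n h
  simp only [Polynomial.eval_eq_sum]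
  exact Finset.sum_le_sum fun i _ => Nat.mul_le_mul_left _ (Nat.pow_le_pow_left h i)

theorem PolyBound.eval (hf : PolyBound size f) (T : Polynomial ℕ) :
    PolyBound size fun a => T.eval (f a) :=
  let ⟨U, hU⟩ := hf; ⟨T.comp U, fun a => by simpa using eval_mono_nat T (hU a)⟩

end PolyBound

/-! ### Memory -/

/-- The work stacks of the programs below. -/
inductive Reg : Type
  | inp | bound | target | flag | err | bad | fst | snd | tmp | arg | res
  deriving DecidableEq

instance : Fintype Reg :=
  ⟨{.inp, .bound, .target, .flag, .err, .bad, .fst, .snd, .tmp, .arg, .res},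
    fun k => by cases k <;> simp⟩

/-- What the work stacks hold between two phases of a program with counters indexed by `V`. -/
structure Mem (V : Type) where
  inp : List Γ'
  bound : ℕ
  target : ℕ
  counter : V → ℕ
  flag : Bool

variable {V : Type}

def Mem.store (m : Mem V) : Store (Reg ⊕ V)
  | .inl .inp => m.inp
  | .inl .bound => List.replicate m.bound one
  | .inl .target => List.replicate m.target one
  | .inl .flag => if m.flag then [one] else []
  | .inr v => List.replicate (m.counter v) one
  | .inl _ => []

variable [DecidableEq V] {O : TM2ComputableAux Γ' Γ'}

theorem RunsIn.congr_right {ι : Type} [DecidableEq ι] {p : Prog ι} {S S' S'' : Store ι} {T T' : ℕ}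
    (h : RunsIn O p S S' T) (hS : S' = S'') (hT : T ≤ T') : RunsIn O p S S'' T' :=
  hS ▸ h.mono hT

/-! ### Searching through all values of the counters -/

/-- Run `p` for all values below `bound` of the counters in a list. -/
def search (p : Prog (Reg ⊕ V)) : List V → Prog (Reg ⊕ V)
  | [] => p
  | v :: vs => .seq (copy (.inl .bound) (.inr v) (.inl .tmp))
      (.while (.inr v) Option.isSome (.seq (.pop (.inr v)) (search p vs)))

/-- The time needed for the search. -/
def searchTime (N T : ℕ) : ℕ → ℕ
  | 0 => T
  | k + 1 => 7 * N + 2 + (N * (1 + (1 + searchTime N T k)) + 1)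

/-- Each counter multiplies the time by about `N`. The bound is polynomial because the number `k` of
counters does not depend on the input. -/
theorem PolyBound.searchTime {α : Type} {size N T : α → ℕ} (hN : PolyBound size N)
    (hT : PolyBound size T) (k : ℕ) : PolyBound size fun a => searchTime (N a) (T a) k := by
  induction k with
  | zero => exact hT
  | succ k ih =>
    exact (((PolyBound.const 7).mul hN).add (.const 2)).add
      ((hN.mul ((PolyBound.const 1).add ((PolyBound.const 1).add ih))).add (.const 1))

-- Every counter is filled up to `N` and popped before the inner search, so it takes the values `N -
-- 1, ..., 0`. The flag accumulates the disjunction of the tests. A counter is zero before and after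
-- its loop, so inner loops can be restarted.
open Classical in
theorem runsIn_search {p : Prog (Reg ⊕ V)} {inp : List Γ'} {N c T : ℕ} {Q : (V → ℕ) → Prop}
    (hp : ∀ x f, (∀ v, x v < N) → RunsIn O p (Mem.store ⟨inp, N, c, x, f⟩)
      (Mem.store ⟨inp, N, c, x, f || decide (Q x)⟩) T)
    (vs : List V) (x : V → ℕ) (f : Bool) (hx : ∀ v, x v < N) (hvs : ∀ v ∈ vs, x v = 0)
    (hd : vs.Nodup) :
    RunsIn O (search p vs) (Mem.store ⟨inp, N, c, x, f⟩)
      (Mem.store ⟨inp, N, c, x, f || decide (∃ y, (∀ v, y v < N) ∧ (∀ v ∉ vs, y v = x v) ∧ Q y)⟩)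
      (searchTime N T vs.length) := by
  induction vs generalizing x f with
  | nil =>
    refine (hp x f hx).congr_right ?_ le_rfl
    congr 3
    rw [decide_eq_decide]
    constructor
    · exact fun h => ⟨x, hx, by simp, h⟩
    · rintro ⟨y, _, hy, h⟩
      rwa [show y = x from funext fun v => hy v (by simp)] at h
  | cons v vs ih =>
    obtain ⟨hv, hd⟩ := List.nodup_cons.1 hd
    have hxv : x v = 0 := hvs v (by simp)
    have h1 := runsIn_copy (O := O) (k := .inl Reg.bound) (v := .inr v) (tmp := .inl .tmp)
      (by simp) (by simp) (by simp) (Mem.store ⟨inp, N, c, x, f⟩) rfl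
    have h2 := runsIn_while (O := O) (k := .inr v) (c := Option.isSome)
      -- Loop invariant: after `i` rounds the flag covers all assignments in which `v` has value at
      -- least `N - i`.
      (p := .seq (.pop (.inr v)) (search p vs)) (T := 1 + searchTime N T vs.length) N
      (fun i => Mem.store ⟨inp, N, c, update x v (N - i), f || decide (∃ y, (∀ v, y v < N) ∧
        (∀ w ∉ vs, w ≠ v → y w = x w) ∧ N - i ≤ y v ∧ Q y)⟩)
      (fun i hi => by simp [Mem.store, List.head?_replicate]; omega)
      (by simp [Mem.store]) (fun i hi => by
        have := (runsIn_pop (O := O) (.inr v) (S := Mem.store ⟨inp, N, c, update x v (N - i),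
          f || decide (∃ y, (∀ v, y v < N) ∧
            (∀ w ∉ vs, w ≠ v → y w = x w) ∧ N - i ≤ y v ∧ Q y)⟩))
        have := this.congr_right (S'' := Mem.store ⟨inp, N, c, update x v (N - (i + 1)),
          f || decide (∃ y, (∀ v, y v < N) ∧
            (∀ w ∉ vs, w ≠ v → y w = x w) ∧ N - i ≤ y v ∧ Q y)⟩) (by
          funext k
          rcases k with k | w
          · cases k <;> simp [Mem.store]
          · by_cases h : w = v
            · subst h
              simp [Mem.store, List.tail_replicate, Nat.sub_sub]
            · simp [Mem.store, h]) le_rfl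
        refine (this.seq (ih (update x v (N - (i + 1))) _ ?_ ?_ hd)).congr_right ?_ le_rfl
        · intro w
          by_cases h : w = v
          · subst h; simp; omega
          · simpa [h] using hx w
        · intro w hw
          have : w ≠ v := fun h => hv (h ▸ hw)
          simpa [this] using hvs w (by simp [hw])
        · congr 2
          rw [Bool.or_assoc]
          congr 1
          rw [← Bool.decide_or, decide_eq_decide]
          constructor
          · rintro (⟨y, hy, h1, h2, h3⟩ | ⟨y, hy, h1, h2⟩)
            · exact ⟨y, hy, h1, by omega, h3⟩
            · refine ⟨y, hy, fun w hw hwv => ?_, ?_, h2⟩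
              · simpa [hwv] using h1 w hw
              · have := h1 v hv
                simp at this; omega
          · rintro ⟨y, hy, h1, h2, h3⟩
            by_cases h : N - i ≤ y v
            · exact Or.inl ⟨y, hy, h1, h, h3⟩
            · refine Or.inr ⟨y, hy, fun w hw => ?_, h3⟩
              by_cases hwv : w = v
              · subst hwv; simp; omega
              · simpa [hwv] using h1 w hw hwv)
    have h3 := h1.congr_right (S'' := Mem.store ⟨inp, N, c, update x v (N - 0),
        f || decide (∃ y, (∀ v, y v < N) ∧
          (∀ w ∉ vs, w ≠ v → y w = x w) ∧ N - 0 ≤ y v ∧ Q y)⟩) (by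
      -- Before the first round the invariant asks for a value `≥ N`, which no admissible assignment
      -- has.
      have : ¬ (∃ y : V → ℕ, (∀ v, y v < N) ∧ (∀ w ∉ vs, w ≠ v → y w = x w) ∧
          N - 0 ≤ y v ∧ Q y) := by
        rintro ⟨y, hy, -, h, -⟩
        have := hy v
        omega
      rw [decide_eq_false this, Bool.or_false]
      funext k
      rcases k with k | w
      · cases k <;> simp [Mem.store]
      · by_cases h : w = v
        · subst h
          simp [Mem.store, hxv]
        · simp [Mem.store, h]) le_rfl
    refine (h3.seq h2).congr_right ?_ (by simp [searchTime, Mem.store])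
    have e1 : update x v (N - N) = x := by
      rw [Nat.sub_self, ← hxv, update_eq_self]
    rw [e1]
    congr 3
    rw [decide_eq_decide]
    refine exists_congr fun y => and_congr_right fun _ => ?_
    simp only [Nat.sub_self, Nat.zero_le, true_and, List.mem_cons, not_or]
    refine and_congr_left fun _ => forall_congr' fun w => ?_
    tauto

/-! ### Testing one candidate solution -/

/-- Call the machine and set the flag if the answer has as many symbols as the target. -/
def accept : Prog (Reg ⊕ V) :=
  .seq (.call (.inl .arg) (.inl .res))
    (.seq (copy (.inl .target) (.inl .fst) (.inl .tmp))
      (.seq (diff (.inl .res) (.inl .fst) (.inl .err))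
        (.ite (.inl .err) Option.isSome (clear (.inl .err))
          (.ite (.inl .flag) Option.isSome .skip (.push (.inl .flag) one)))))

/-- Comparing lengths suffices, since the answers of interest are tallies, which are determined by
their length. -/
theorem runsIn_accept (m : Mem V) {w u : List Γ'} {n : ℕ} (h : Answers O w u n) :
    RunsIn O accept (update m.store (.inl .arg) w.reverse)
      (Mem.store { m with flag := m.flag || decide (u.length = m.target) })
      (w.length + n + 7 * u.length + 12 * m.target + 12) := by
  have h1 : RunsIn O (.call (.inl .arg) (.inl .res)) (update m.store (.inl .arg) w.reverse)
      (update m.store (.inl .res) u.reverse) (w.length + 1 + n + (u.length + 1)) := by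
    refine ⟨_, le_rfl, ?_⟩
    have := Exec.call (O := O) (i := (.inl .arg : Reg ⊕ V)) (o := .inl .res)
      (S := update m.store (.inl .arg) w.reverse) (by simp) h
    convert this using 1
    funext k
    rcases k with k | v
    · cases k <;> simp [Mem.store]
    · simp [Mem.store]
  have h2 := runsIn_copy (O := O) (k := .inl .target) (v := .inl .fst) (tmp := .inl .tmp)
      (by simp) (by simp) (by simp) (update m.store (.inl .res) u.reverse) rfl
  have h3 := runsIn_diff (O := O) (k := (.inl .res : Reg ⊕ V)) (k' := .inl .fst) (e := .inl .err)
    (by simp) (by simp) (by simp) (update (update m.store (.inl .res) u.reverse) (.inl .fst)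
      ((update m.store (.inl .res) u.reverse (.inl .target)).reverse ++
        (update m.store (.inl .res) u.reverse (.inl .fst))))
  replace h3 := h3.congr_right (S'' := update m.store (.inl .err)
      (List.replicate (u.length - m.target + (m.target - u.length)) one)) (by
    funext k
    rcases k with k | v
    · cases k <;> simp [Mem.store]
    · simp [Mem.store]) le_rfl
  have h4 : RunsIn O (.ite (.inl .err) Option.isSome (clear (.inl .err))
      (.ite (.inl .flag) Option.isSome .skip (.push (.inl .flag) one)))
      (update m.store (.inl .err)
        (List.replicate (u.length - m.target + (m.target - u.length)) one))
      (Mem.store { m with flag := m.flag || decide (u.length = m.target) })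
      (2 * (u.length + m.target) + 3) := by
    by_cases hu : u.length = m.target
    · rw [hu, Nat.sub_self, decide_eq_true rfl, Bool.or_true]
      refine (RunsIn.ite_false (by simp) (T := 2) ?_).mono (by omega)
      by_cases hf : m.flag = true
      · refine (RunsIn.ite_true (by simp [Mem.store, hf]) runsIn_skip).congr_right ?_ le_rfl
        funext k
        rcases k with k | v
        · cases k <;> simp [Mem.store, hf]
        · simp [Mem.store]
      · refine (RunsIn.ite_false (by simp [Mem.store, hf])
          (runsIn_push _ _)).congr_right ?_ le_rfl
        funext k
        rcases k with k | v
        · cases k <;> simp [Mem.store, hf]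
        · simp [Mem.store]
    · refine (RunsIn.ite_true (by simp [List.head?_replicate]; omega)
        (runsIn_clear _ _)).congr_right ?_ (by simp; omega)
      funext k
      rcases k with k | v
      · cases k <;> simp [Mem.store, hu]
      · simp [Mem.store]
  refine (h1.seq (h2.seq (h3.seq h4))).mono ?_
  simp [Mem.store]
  omega

/-- Unless `check` signals an error, run `assemble` and test its result. -/
def guarded (check assemble : Prog (Reg ⊕ V)) : Prog (Reg ⊕ V) :=
  .seq check (.ite (.inl .bad) Option.isSome (clear (.inl .bad)) (.seq assemble accept))

-- The check comes first because the machine is known to answer only on encodings of genuine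
-- elections; an invalid assignment must not lead to a call. `B` bounds each ingredient separately:
-- check and assembly contribute `2 * B`, and the acceptance test at most `21 * B + 12`.
open Classical in
theorem runsIn_guarded {check assemble : Prog (Reg ⊕ V)} (m : Mem V) {e : List Γ'} {B : ℕ}
    {Q : Prop}
    (hcheck : RunsIn O check m.store (update m.store (.inl .bad) e) B)
    (he : e.length ≤ B) (htarget : m.target ≤ B) (hbad : e ≠ [] → ¬ Q)
    (hgood : e = [] → ∃ w u n, RunsIn O assemble m.store
      (update m.store (.inl .arg) w.reverse) B ∧ Answers O w u n ∧ w.length ≤ B ∧ n ≤ B ∧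
        u.length ≤ B ∧ (Q ↔ u.length = m.target)) :
    RunsIn O (guarded check assemble) m.store
      (Mem.store { m with flag := m.flag || decide Q }) (23 * B + 13) := by
  by_cases h0 : e = []
  · obtain ⟨w, u, n, ha, hans, hw, hn, hu, hQ⟩ := hgood h0
    have h1 := hcheck.congr_right (S'' := m.store) (by
      subst h0
      exact update_eq_self (.inl .bad) m.store) le_rfl
    have h2 := ha.seq (runsIn_accept m hans)
    refine (h1.seq (RunsIn.ite_false (by simp [Mem.store]) h2)).congr_right ?_ (by omega)
    simp only [decide_eq_decide.2 hQ]
  · refine (hcheck.seq (RunsIn.ite_true (by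
      obtain ⟨a, l, rfl⟩ := List.exists_cons_of_ne_nil h0
      simp) (runsIn_clear _ _))).congr_right ?_ (by simp; omega)
    funext k
    rcases k with k | v
    · cases k <;> simp [Mem.store, hbad h0]
    · simp [Mem.store]

/-! ### Decision by exhaustive search -/

/-- Read two tallies from the input; add `k` to the first number. -/
def parse (k : ℕ) : Prog (Reg ⊕ V) :=
  .seq (moveWhile (fun a => decide (a = some one)) (.inl .inp) (.inl .bound))
    (.seq (.pop (.inl .inp)) (.seq (pushAll (.inl .bound) (List.replicate k one))
      (.seq (moveWhile (fun a => decide (a = some one)) (.inl .inp) (.inl .target))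
        (.seq (.pop (.inl .inp)) (.push (.inl .target) one)))))

/-- The summand `k` lets counters range up to the first number inclusively when needed. The target
receives one extra symbol to match the closing comma of the tally with which the machine answers. -/
theorem runsIn_parse (k p c : ℕ) (w : List Γ') :
    RunsIn O (parse k)
      (update (fun _ : Reg ⊕ V => []) (.inl .inp)
        (UpToL.encodeTally p ++ UpToL.encodeTally c ++ w))
      (Mem.store ⟨w, p + k, c + 1, fun _ => 0, false⟩) (3 * p + 3 * c + k + 7) := by
  have h1 := runsIn_moveWhile (O := O) (c := fun a => decide (a = some one))
    (k := (.inl .inp : Reg ⊕ V)) (k' := .inl .bound) (by simp) (List.replicate p one)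
    (Γ'.comma :: (UpToL.encodeTally c ++ w)) (by simp) (by simp)
    (update (fun _ => []) (.inl .inp) (UpToL.encodeTally p ++ UpToL.encodeTally c ++ w))
    (by simp [UpToL.encodeTally])
  replace h1 := h1.congr_right (S'' := Mem.store ⟨Γ'.comma :: (UpToL.encodeTally c ++ w), p, 0,
    fun _ => 0, false⟩) (by
      funext k
      rcases k with k | v
      · cases k <;> simp [Mem.store]
      · simp [Mem.store]) le_rfl
  have h2 := (runsIn_pop (O := O) (S := Mem.store ⟨Γ'.comma :: (UpToL.encodeTally c ++ w), p, 0,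
    fun _ : V => 0, false⟩) (.inl .inp)).congr_right
    (S'' := Mem.store ⟨UpToL.encodeTally c ++ w, p, 0, fun _ => 0, false⟩) (by
      funext k
      rcases k with k | v
      · cases k <;> simp [Mem.store]
      · simp [Mem.store]) le_rfl
  have h3 := (runsIn_pushAll (O := O) (.inl .bound) (List.replicate k one)
    (Mem.store ⟨UpToL.encodeTally c ++ w, p, 0, fun _ : V => 0, false⟩)).congr_right
    (S'' := Mem.store ⟨UpToL.encodeTally c ++ w, p + k, 0, fun _ => 0, false⟩) (by
      funext j
      rcases j with j | v
      · cases j <;> simp [Mem.store, add_comm]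
      · simp [Mem.store]) le_rfl
  have h4 := runsIn_moveWhile (O := O) (c := fun a => decide (a = some one))
    (k := (.inl .inp : Reg ⊕ V)) (k' := .inl .target) (by simp) (List.replicate c one)
    (Γ'.comma :: w) (by simp) (by simp)
    (Mem.store ⟨UpToL.encodeTally c ++ w, p + k, 0, fun _ : V => 0, false⟩)
    (by simp [UpToL.encodeTally, Mem.store])
  have h5 := (h4.seq ((runsIn_pop (.inl .inp)).seq (runsIn_push (.inl .target) one))).congr_right
    (S'' := Mem.store ⟨w, p + k, c + 1, fun _ => 0, false⟩) (by
      funext j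
      rcases j with j | v
      · cases j <;> simp [Mem.store, List.replicate_succ]
      · simp [Mem.store]) le_rfl
  refine (h1.seq (h2.seq (h3.seq h5))).mono ?_
  simp
  omega

/-- Read the input, search for a solution and tidy up. -/
noncomputable def decider [Fintype V] (k : ℕ) (p : Prog (Reg ⊕ V)) : Prog (Reg ⊕ V) :=
  .seq (parse k) (.seq (search p Finset.univ.toList)
    (.seq (clear (.inl .inp)) (.seq (clear (.inl .bound)) (clear (.inl .target)))))

open Classical in
/-- If a program tests in polynomial time whether given values of the counters form a solution,
then it is decidable in polynomial time whether there is a solution. -/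
theorem polyTimeDecidable_exists [Fintype V] {α : Type} {enc : α → List Γ'} {p c : α → ℕ}
    {w : α → List Γ'} {k : ℕ} {B : α → ℕ} {q : Prog (Reg ⊕ V)} {Q : α → (V → ℕ) → Prop}
    (henc : ∀ a, enc a = UpToL.encodeTally (p a) ++ UpToL.encodeTally (c a) ++ w a)
    (hpos : ∀ a, 0 < p a + k)
    (hB : PolyBound (fun a => (enc a).length) B)
    (hq : ∀ a x f, (∀ v, x v < p a + k) →
      RunsIn O q (Mem.store ⟨w a, p a + k, c a + 1, x, f⟩)
        (Mem.store ⟨w a, p a + k, c a + 1, x, f || decide (Q a x)⟩) (B a)) :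
    UpToL.PolyTimeDecidable enc (fun a => ∃ x : V → ℕ, (∀ v, x v < p a + k) ∧ Q a x) := by
  have hp : PolyBound (fun a => (enc a).length) p :=
    .of_le fun a => by simp [henc, UpToL.encodeTally, add_assoc]
  have hc : PolyBound (fun a => (enc a).length) c :=
    .of_le fun a => by simp [henc, UpToL.encodeTally]; omega
  have hw : PolyBound (fun a => (enc a).length) fun a => (w a).length :=
    .of_le fun a => by simp [henc]; omega
  -- The exponent is the number of elements of `V`, a constant.
  have hs := PolyBound.searchTime (hp.add (.const k)) hB (Finset.univ : Finset V).toList.length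
  have htotal := ((((PolyBound.const 10).mul hp).add ((PolyBound.const 10).mul hc)).add
    ((PolyBound.const 10).mul hw)).add (hs.add (.const (10 * k + 20)))
  obtain ⟨T, hT⟩ := htotal
  refine polyTimeDecidable_of_runsIn (O := O) (p := decider k q) (inp := .inl .inp)
    (flag := .inl .flag) T fun a => ?_
  have h1 := runsIn_parse (O := O) (V := V) k (p a) (c a) (w a)
  rw [← henc a] at h1
  have h2 := runsIn_search (hq a) Finset.univ.toList (fun _ => 0) false (fun _ => hpos a)
    (fun _ _ => rfl) (Finset.nodup_toList _)
  have h3 := h1.seq (h2.seq ((runsIn_clear (.inl .inp) _).seq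
    ((runsIn_clear (.inl .bound) _).seq (runsIn_clear (.inl .target) _))))
  refine h3.congr_right ?_ (le_trans ?_ (hT a))
  · funext j
    rcases j with j | v
    · cases j <;> simp [Mem.store]
    · simp [Mem.store]
  · simp [Mem.store]
    omega

/-! ### Programs that write a word on a work stack -/

/-- Run a list of programs one after the other. -/
def seqAll {ι : Type} : List (Prog ι) → Prog ι
  | [] => .skip
  | p :: l => .seq p (seqAll l)

/-- Running `p` with the memory `m` pushes the word `w`, first symbol first, on the stack `k`. -/
def Appends (O : TM2ComputableAux Γ' Γ') (m : Mem V) (k : Reg) (p : Prog (Reg ⊕ V)) (w : List Γ')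
    (T : ℕ) : Prop :=
  ∀ l, RunsIn O p (update m.store (.inl k) l) (update m.store (.inl k) (w.reverse ++ l)) T

section Appends

variable {m : Mem V} {k : Reg} {p q : Prog (Reg ⊕ V)} {w w' : List Γ'} {T T' : ℕ}

theorem Appends.runsIn (h : Appends O m k p w T) (hk : m.store (.inl k) = []) :
    RunsIn O p m.store (update m.store (.inl k) w.reverse) T := by
  have := h []
  rwa [← hk, update_eq_self, hk, List.append_nil] at this

theorem appends_pushAll (w : List Γ') :
    Appends O m k (pushAll (.inl k) w) w (w.length + 1) := fun l => by
  have := runsIn_pushAll (O := O) (.inl k) w (update m.store (.inl k) l)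
  simpa using this

theorem Appends.seq (h : Appends O m k p w T) (h' : Appends O m k q w' T') :
    Appends O m k (.seq p q) (w ++ w') (T + T') := fun l => by
  have := (h l).seq (h' _)
  simpa using this

theorem Appends.seqAll {A : Type} {f : A → Prog (Reg ⊕ V)} {g : A → List Γ'} (l : List A)
    (h : ∀ a ∈ l, Appends O m k (f a) (g a) T) :
    Appends O m k (seqAll (l.map f)) (l.flatMap g) (l.length * T + 1) := by
  induction l with
  | nil =>
    intro l
    simpa [StackProg.seqAll] using
      (runsIn_skip : RunsIn O .skip (update m.store (.inl k) l) _ 1)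
  | cons a l ih =>
    intro s
    have := ((h a (by simp)).seq (ih fun b hb => h b (by simp [hb]))) s
    simp only [List.flatMap_cons, List.length_cons]
    exact this.mono (by rw [Nat.succ_mul]; omega)

theorem appends_copy {j : Reg ⊕ V} (hk : k ≠ .tmp) (hj : j ≠ .inl .tmp) (hjk : j ≠ .inl k) :
    Appends O m k (copy j (.inl k) (.inl .tmp)) (m.store j) (7 * (m.store j).length + 2) :=
  fun l => by
  have := runsIn_copy (O := O) hj hjk (by simpa using hk.symm) (update m.store (.inl k) l)
    (by simp [hk.symm, Mem.store])
  simpa [hjk] using this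

theorem appends_forEach (hk : k ≠ .tmp) (v : V) (w : List Γ') :
    Appends O m k (forEach (.inr v) (.inl .tmp) (pushAll (.inl k) w))
      (List.replicate (m.counter v) w).flatten (m.counter v * (w.length + 7) + 2) := fun l => by
  have := runsIn_forEach_pushAll (O := O) (k := .inr v) (v := .inl k) (tmp := .inl .tmp)
    (by simp) (by simp) (by simpa using hk.symm) w (update m.store (.inl k) l)
    (by simp [hk.symm, Mem.store])
  simpa [Mem.store] using this

theorem Appends.mono (h : Appends O m k p w T) (hT : T ≤ T') : Appends O m k p w T' :=
  fun l => (h l).mono hT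

end Appends

/-! ### The sum of all counters -/

/-- Signal an error unless the sum of the counters in a list is one less than `bound`. -/
def checkSum (vs : List V) : Prog (Reg ⊕ V) :=
  .seq (.seq (seqAll (vs.map fun v => copy (.inr v) (.inl .fst) (.inl .tmp)))
      (pushAll (.inl .fst) [one]))
    (.seq (copy (.inl .bound) (.inl .snd) (.inl .tmp)) (diff (.inl .fst) (.inl .snd) (.inl .bad)))

theorem flatMap_replicate {A B : Type} (l : List A) (x : A → ℕ) (b : B) :
    l.flatMap (fun a => List.replicate (x a) b) = List.replicate (l.map x).sum b := by
  induction l with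
  | nil => rfl
  | cons a l ih => simp [ih]

/-- Used with `bound = t + 1`, where it accepts exactly the counters with sum `t`; the extra symbol
pushed on `fst` accounts for the one. -/
theorem runsIn_checkSum (m : Mem V) (vs : List V) (hx : ∀ v, m.counter v ≤ m.bound) :
    ∃ e : List Γ', (e = [] ↔ (vs.map m.counter).sum + 1 = m.bound) ∧
      e.length ≤ vs.length * m.bound + 1 + m.bound ∧
      RunsIn O (checkSum vs) m.store (update m.store (.inl .bad) e)
        (vs.length * (11 * m.bound + 2) + 10 * m.bound + 20) := by
  set s := (vs.map m.counter).sum with hs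
  have hsum : s ≤ vs.length * m.bound := by
    have := List.sum_le_card_nsmul (vs.map m.counter) m.bound (by
      intro n hn
      obtain ⟨v, -, rfl⟩ := List.mem_map.1 hn
      exact hx v)
    simpa using this
  refine ⟨List.replicate (s + 1 - m.bound + (m.bound - (s + 1))) one, ?_, ?_, ?_⟩
  · rw [List.replicate_eq_nil_iff]; omega
  · rw [List.length_replicate]; omega
  · have h1 : Appends O m .fst (seqAll (vs.map fun v => copy (.inr v) (.inl .fst) (.inl .tmp)))
        (vs.flatMap fun v => m.store (.inr v)) (vs.length * (7 * m.bound + 2) + 1) :=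
      Appends.seqAll _ fun v _ => (appends_copy (by simp) (by simp) (by simp)).mono (by
        have := hx v
        simp [Mem.store]; omega)
    have h2 := (h1.seq (appends_pushAll [one])).runsIn rfl
    have e1 : (vs.flatMap fun v => m.store (.inr v)) = List.replicate s one :=
      flatMap_replicate vs m.counter one
    rw [e1] at h2
    have h3 := runsIn_copy (O := O) (k := .inl .bound) (v := .inl .snd) (tmp := .inl .tmp)
      (by simp) (by simp) (by simp)
      (update m.store (.inl .fst) (List.replicate s one ++ [one]).reverse) rfl
    have h4 := h2.seq (h3.seq (runsIn_diff (k := .inl .fst) (k' := .inl .snd) (e := .inl .bad)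
      (by simp) (by simp) (by simp) _))
    refine h4.congr_right ?_ ?_
    · funext j
      rcases j with j | v
      · cases j <;> simp [Mem.store]
      · simp [Mem.store]
    · simp [Mem.store]
      nlinarith

/-! ### Distinctness of counters -/

/-- Signal an error if two counters are equal. -/
def checkNe (vw : V × V) : Prog (Reg ⊕ V) :=
  .seq (.seq (copy (.inr vw.1) (.inl .fst) (.inl .tmp))
      (.seq (copy (.inr vw.2) (.inl .snd) (.inl .tmp))
        (diff (.inl .fst) (.inl .snd) (.inl .err))))
    (.ite (.inl .err) Option.isSome (clear (.inl .err)) (.push (.inl .bad) one))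

theorem appends_checkNe (m : Mem V) (vw : V × V) (hx : ∀ v, m.counter v ≤ m.bound) :
    Appends O m .bad (checkNe vw) (if m.counter vw.1 = m.counter vw.2 then [one] else [])
      (25 * m.bound + 10) := fun l => by
  have hv := hx vw.1
  have hw := hx vw.2
  have h1 := runsIn_copy (O := O) (k := .inr vw.1) (v := .inl .fst) (tmp := .inl .tmp)
    (by simp) (by simp) (by simp) (update m.store (.inl .bad) l) rfl
  have h2 := runsIn_copy (O := O) (k := .inr vw.2) (v := .inl .snd) (tmp := .inl .tmp)
    (by simp) (by simp) (by simp) (update (update m.store (.inl .bad) l) (.inl .fst)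
      ((update m.store (.inl .bad) l (.inr vw.1)).reverse ++
        update m.store (.inl .bad) l (.inl .fst))) rfl
  set d := m.counter vw.1 - m.counter vw.2 + (m.counter vw.2 - m.counter vw.1) with hd
  have h3 := (h1.seq (h2.seq (runsIn_diff (k := .inl .fst) (k' := .inl .snd) (e := .inl .err)
    (by simp) (by simp) (by simp) _))).congr_right
      (S'' := update (update m.store (.inl .bad) l) (.inl .err) (List.replicate d one))
      (T' := 21 * m.bound + 6) (by
    funext j
    rcases j with j | v
    · cases j <;> simp [Mem.store, hd]
    · simp [Mem.store]) (by simp [Mem.store]; omega)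
  have h4 : RunsIn O (.ite (.inl .err) Option.isSome (clear (.inl .err)) (.push (.inl .bad) one))
      (update (update m.store (.inl .bad) l) (.inl .err) (List.replicate d one))
      (update m.store (.inl .bad)
        ((if m.counter vw.1 = m.counter vw.2 then [one] else []).reverse ++ l))
      (2 * m.bound + 2) := by
    by_cases h : m.counter vw.1 = m.counter vw.2
    · refine (RunsIn.ite_false (by simp; omega) (runsIn_push _ _)).congr_right ?_ (by omega)
      have hd0 : d = 0 := by omega
      funext j
      rcases j with j | v
      · cases j <;> simp [Mem.store, h, hd0]
      · simp [Mem.store]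
    · refine (RunsIn.ite_true (by simp [List.head?_replicate]; omega)
        (runsIn_clear _ _)).congr_right ?_ (by simp; omega)
      funext j
      rcases j with j | v
      · cases j <;> simp [Mem.store, h]
      · simp [Mem.store]
  exact (h3.seq h4).mono (by omega)

/-- The pairs of counters that must differ. -/
def distinctPairs (sh : List (List V)) : List (V × V) :=
  sh.flatMap fun vs => (vs ×ˢ vs).filter fun vw => vw.1 ≠ vw.2

/-- Signal an error unless the counters within each of the lists are distinct. -/
def checkDistinct (sh : List (List V)) : Prog (Reg ⊕ V) :=
  seqAll ((distinctPairs sh).map checkNe)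

theorem runsIn_checkDistinct (m : Mem V) (sh : List (List V)) (hsh : ∀ vs ∈ sh, vs.Nodup)
    (hx : ∀ v, m.counter v ≤ m.bound) :
    ∃ e : List Γ', (e = [] ↔ ∀ vs ∈ sh, (vs.map m.counter).Nodup) ∧
      e.length ≤ (distinctPairs sh).length ∧
      RunsIn O (checkDistinct sh) m.store (update m.store (.inl .bad) e)
        ((distinctPairs sh).length * (25 * m.bound + 10) + 1) := by
  refine ⟨_, ?_, ?_, (Appends.seqAll (distinctPairs sh)
    fun vw _ => appends_checkNe m vw hx).runsIn rfl⟩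
  · simp only [List.reverse_eq_nil_iff, List.flatMap_eq_nil_iff, ite_eq_right_iff,
      List.cons_ne_self, imp_false, distinctPairs, List.mem_flatMap, List.mem_filter]
    constructor
    · intro h vs hvs
      refine (List.nodup_map_iff_inj_on (hsh vs hvs)).2 fun v hv w hw hvw => ?_
      by_contra hne
      exact h (v, w) ⟨vs, hvs, by simp [hv, hw], by simpa using hne⟩ hvw
    · rintro h ⟨v, w⟩ ⟨vs, hvs, hvw, hne⟩ heq
      have hvw := List.pair_mem_product.1 hvw
      exact (by simpa using hne : v ≠ w)
        ((List.nodup_map_iff_inj_on (hsh vs hvs)).1 (h vs hvs) v hvw.1 w hvw.2 heq)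
  · rw [List.length_reverse, List.length_flatMap]
    have := List.sum_le_card_nsmul ((distinctPairs sh).map fun vw =>
      (if m.counter vw.1 = m.counter vw.2 then [one] else []).length) 1 (by
      intro n hn
      obtain ⟨vw, -, rfl⟩ := List.mem_map.1 hn
      split_ifs <;> simp)
    simpa using this

/-! ### Trying several tests -/

-- This serves to try all choices of lengths of the absent votes, of which there are constantly many
-- when `t` is fixed.
open Classical in
theorem runsIn_seqAll_flag {A : Type} {f : A → Prog (Reg ⊕ V)} {Q : A → Prop} {T : ℕ} (l : List A)
    (m : Mem V)
    (h : ∀ a ∈ l, ∀ b : Bool, RunsIn O (f a) (Mem.store { m with flag := b })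
      (Mem.store { m with flag := b || decide (Q a) }) T) :
    RunsIn O (seqAll (l.map f)) m.store
      (Mem.store { m with flag := m.flag || decide (∃ a ∈ l, Q a) }) (l.length * T + 1) := by
  induction l generalizing m with
  | nil => exact runsIn_skip.congr_right (by simp) (by simp)
  | cons a l ih =>
    have h1 := h a (by simp) m.flag
    have h2 := ih { m with flag := m.flag || decide (Q a) } fun b hb => h b (by simp [hb])
    refine (h1.seq h2).congr_right ?_ (by simp only [List.length_cons, Nat.succ_mul]; omega)
    congr 2
    simp [Bool.or_assoc]

end StackProg

/-! ### Application to the problem with absent votes -/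

namespace UpToL

open Turing Computability Function StackProg

variable {L : ℕ}

theorem PolyTimeDecidable.congr {α Γ : Type} {enc : α → List Γ} {p p' : α → Prop}
    (h : PolyTimeDecidable enc p) (hp : ∀ a, p a ↔ p' a) : PolyTimeDecidable enc p' := by
  rwa [show p' = p from funext fun a => propext (hp a).symm]

/-- The same machine works, since it sees only the string. -/
theorem PolyTimeDecidable.comap {α β Γ : Type} {enc : α → List Γ} {p : α → Prop}
    (h : PolyTimeDecidable enc p) {enc' : β → List Γ} {p' : β → Prop} (g : β → α)
    (henc : ∀ b, enc' b = enc (g b)) (hp : ∀ b, p (g b) ↔ p' b) : PolyTimeDecidable enc' p' := by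
  obtain ⟨f, hf, ⟨M⟩⟩ := h
  obtain rfl : enc' = fun b => enc (g b) := funext henc
  exact ⟨f ∘ g, fun b => (hf _).trans (hp b),
    ⟨{ toTM2ComputableAux := M.toTM2ComputableAux
       time := M.time
       outputsFun := fun b => M.outputsFun (g b) }⟩⟩

theorem exists_answers {r : VotingRule L}
    (M : TM2ComputableInPolyTime (encodeElection (L := L)) encodeTally r.winner) (E : Election L) :
    ∃ n ≤ M.time.eval (encodeElection E).length,
      Answers M.toTM2ComputableAux (encodeElection E) (encodeTally (r.winner E)) n :=
  ⟨(M.outputsFun E).steps, (M.outputsFun E).steps_le_m, (M.outputsFun E).evals_in_steps⟩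

theorem length_encodeTally (k : ℕ) : (encodeTally k).length = k + 1 := by simp [encodeTally]

/-! ### A fixed number of candidates -/

section FixedM

variable {m : ℕ}

theorem Ballot.ranking_injective : Injective (Ballot.ranking : Ballot m L → _) :=
  fun _ _ h => Ballot.ext h

/-- A ballot is a duplicate-free list over a finite type. This makes the number of counters finite
for fixed `m`. -/
instance : Finite (Ballot m L) :=
  Finite.of_injective (fun b : Ballot m L => (⟨b.ranking, b.nodup⟩ : {l : List (Fin m) // l.Nodup}))
    fun _ _ h => Ballot.ext (congrArg Subtype.val h)

/-- The profile in which every ballot `v` of a list occurs `x v` times. -/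
def profileOfCounts (vs : List (Ballot m L)) (x : Ballot m L → ℕ) : Profile m L :=
  vs.flatMap fun v => List.replicate (x v) v

theorem length_profileOfCounts (vs : List (Ballot m L)) (x : Ballot m L → ℕ) :
    (profileOfCounts vs x).length = (vs.map x).sum := by
  simp [profileOfCounts, List.length_flatMap]

theorem encodeProfile_profileOfCounts (vs : List (Ballot m L)) (x : Ballot m L → ℕ) :
    encodeProfile (profileOfCounts vs x) =
      vs.flatMap fun v => (List.replicate (x v) (encodeBallot v)).flatten := by
  rw [encodeProfile, profileOfCounts, List.flatMap_assoc]
  congr 1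
  funext v
  rw [List.flatMap, List.map_replicate]

theorem length_encodeProfile_profileOfCounts_le (vs : List (Ballot m L)) (x : Ballot m L → ℕ)
    {N : ℕ} (hx : ∀ v, x v ≤ N) :
    (encodeProfile (profileOfCounts vs x)).length ≤
      N * (vs.map fun v => (encodeBallot v).length).sum := by
  rw [encodeProfile_profileOfCounts, List.length_flatMap, ← List.sum_map_mul_left]
  refine List.sum_le_sum fun v _ => ?_
  simpa using Nat.mul_le_mul_right _ (hx v)

/-- Together with anonymity this reduces the search over profiles to a search over vectors of
counts. -/
theorem profileOfCounts_count_perm [DecidableEq (Ballot m L)] [Fintype (Ballot m L)]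
    (P : Profile m L) :
    (profileOfCounts Finset.univ.toList fun v => P.count v).Perm P := by
  rw [List.perm_iff_count]
  intro v
  rw [profileOfCounts, List.count_flatMap]
  have : (List.map (List.count v ∘ fun w => List.replicate (P.count w) w)
      (Finset.univ : Finset (Ballot m L)).toList).sum =
      ∑ w : Ballot m L, if w = v then P.count w else 0 := by
    rw [Finset.sum_map_toList]
    refine Finset.sum_congr rfl fun w _ => ?_
    simp [List.count_replicate]
  rw [this]
  simp

variable [DecidableEq (Ballot m L)]

/-- Write the election with the absent votes given by the counters. -/
def assembleCounts (vs : List (Ballot m L)) : Prog (Reg ⊕ Ballot m L) :=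
  .seq (pushAll (.inl .arg) (encodeTally m))
    (.seq (seqAll (vs.map fun v =>
        forEach (.inr v) (.inl .tmp) (pushAll (.inl .arg) (encodeBallot v))))
      (copy (.inl .inp) (.inl .arg) (.inl .tmp)))

theorem runsIn_assembleCounts {O : TM2ComputableAux Γ' Γ'} (hm : 0 < m) (vs : List (Ballot m L))
    (M : Mem (Ballot m L)) (P : Profile m L) (hP : M.inp = encodeProfile P) {N S : ℕ}
    (hN : ∀ v, M.counter v ≤ N) (hS : ∀ v ∈ vs, (encodeBallot v).length ≤ S) :
    RunsIn O (assembleCounts vs) M.store (update M.store (.inl .arg)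
      (encodeElection ⟨m, hm, profileOfCounts vs M.counter ++ P⟩).reverse)
      (m + 7 + vs.length * (N * (S + 7) + 2) + 7 * (encodeProfile P).length) := by
  have h1 : Appends O M .arg (seqAll (vs.map fun v =>
      forEach (.inr v) (.inl .tmp) (pushAll (.inl .arg) (encodeBallot v))))
      (vs.flatMap fun v => (List.replicate (M.counter v) (encodeBallot v)).flatten)
      (vs.length * (N * (S + 7) + 2) + 1) :=
    Appends.seqAll vs fun v hv => (appends_forEach (by simp) v _).mono (by
      gcongr
      · exact hN v
      · exact hS v hv)
  have h2 := ((appends_pushAll (O := O) (m := M) (k := .arg) (encodeTally m)).seq (h1.seq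
    (appends_copy (j := .inl .inp) (by simp) (by simp) (by simp)))).runsIn rfl
  refine h2.congr_right ?_ ?_
  · rw [encodeElection, ← encodeProfile_profileOfCounts]
    simp only [encodeProfile, List.flatMap_append]
    congr 4
  · simp only [Mem.store, hP, length_encodeTally]
    omega

end FixedM

theorem wav_fixed_m {r : VotingRule L} (hanon : r.Anonymous) (hpoly : r.PolyTime) (m : ℕ)
    (hm : 0 < m) :
    PolyTimeDecidable
      (fun a : Profile m L × ℕ × Fin m =>
        encodeTally a.2.1 ++ encodeTally (a.2.2 : ℕ) ++ encodeProfile a.1)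
      (fun a => ∃ P' : Profile m L, P'.length = a.2.1 ∧ r m hm (a.1 ++ P') = a.2.2) := by
  classical
  obtain ⟨M⟩ := hpoly
  let _ := Fintype.ofFinite (Ballot m L)
  set vs : List (Ballot m L) := Finset.univ.toList with hvs
  set S := (vs.map fun v => (encodeBallot v).length).sum with hS
  set size : Profile m L × ℕ × Fin m → ℕ := fun a =>
    (encodeTally a.2.1 ++ encodeTally (a.2.2 : ℕ) ++ encodeProfile a.1).length with hsize
  have hp : PolyBound size fun a => a.2.1 :=
    .of_le fun a => by simp [hsize, length_encodeTally]; omega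
  have hw : PolyBound size fun a => (encodeProfile a.1).length :=
    .of_le fun a => by simp [hsize]; omega
  -- `W` bounds the length of every election passed to the machine, using only that each count is at
  -- most `t + 1`. `B` then adds up the times for check and assembly, this length and the machine's
  -- time on it.
  let W : Profile m L × ℕ × Fin m → ℕ := fun a =>
    m + 1 + ((a.2.1 + 1) * S + (encodeProfile a.1).length)
  have hW : PolyBound size W :=
    (PolyBound.const _).add (((hp.add (.const 1)).mul (.const S)).add hw)
  let B : Profile m L × ℕ × Fin m → ℕ := fun a =>
    vs.length * (11 * (a.2.1 + 1) + 2) + 10 * (a.2.1 + 1) + 20 +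
      (m + 7 + vs.length * ((a.2.1 + 1) * (S + 7) + 2) + 7 * (encodeProfile a.1).length) +
      W a + M.time.eval (W a)
  have hB : PolyBound size B := by
    refine PolyBound.add (PolyBound.add (PolyBound.add ?_ ?_) hW) (hW.eval M.time)
    all_goals
      repeat' first
        | exact PolyBound.const _
        | exact hp
        | exact hw
        | apply PolyBound.add
        | apply PolyBound.mul
  refine PolyTimeDecidable.congr (polyTimeDecidable_exists (O := M.toTM2ComputableAux)
    (V := Ballot m L) (p := fun a => a.2.1) (c := fun a => a.2.2)
    (w := fun a => encodeProfile a.1) (k := 1) (B := fun a => 23 * B a + 13)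
    (q := guarded (checkSum vs) (assembleCounts vs))
    (Q := fun a x => (vs.map x).sum = a.2.1 ∧ r m hm (profileOfCounts vs x ++ a.1) = a.2.2)
    (fun a => rfl) (fun a => Nat.succ_pos _) (((PolyBound.const 23).mul hB).add (.const 13)) ?_) ?_
  · intro a x f hx
    have hx' : ∀ v, x v ≤ a.2.1 + 1 := fun v => (hx v).le
    obtain ⟨e, he, hel, hrun⟩ := runsIn_checkSum (O := M.toTM2ComputableAux)
      ⟨encodeProfile a.1, a.2.1 + 1, a.2.2 + 1, x, f⟩ vs hx'
    have hwin := (r m hm (profileOfCounts vs x ++ a.1)).isLt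
    have hlen : (encodeElection ⟨m, hm, profileOfCounts vs x ++ a.1⟩).length ≤ W a := by
      have := length_encodeProfile_profileOfCounts_le vs x hx'
      rw [← hS] at this
      simp only [encodeProfile] at this
      simp only [encodeElection, encodeProfile, List.flatMap_append, List.length_append,
        length_encodeTally, W]
      omega
    obtain ⟨n, hn, hans⟩ := exists_answers M ⟨m, hm, profileOfCounts vs x ++ a.1⟩
    have hn' : n ≤ M.time.eval (W a) := hn.trans (eval_mono_nat M.time hlen)
    refine runsIn_guarded (B := B a) _ (hrun.mono ?_) (hel.trans ?_) ?_ ?_ ?_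
    · simp only [B]; omega
    · have := Nat.mul_le_mul_left vs.length (show a.2.1 + 1 ≤ 11 * (a.2.1 + 1) + 2 by omega)
      simp only [B]; omega
    · have := a.2.2.isLt
      simp only [B]; omega
    · intro hne hQ
      exact hne (he.2 (by simp [hQ.1]))
    · intro h0
      have hsum : (vs.map x).sum = a.2.1 := by simpa using he.1 h0
      refine ⟨_, _, n, (runsIn_assembleCounts hm vs
        ⟨encodeProfile a.1, a.2.1 + 1, a.2.2 + 1, x, f⟩ a.1 rfl (N := a.2.1 + 1) (S := S) hx'
        fun v hv => List.single_le_sum (by simp) _ (List.mem_map_of_mem hv)).mono ?_,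
        hans, hlen.trans ?_, hn'.trans ?_, ?_, ?_⟩
      · simp only [B]; omega
      · simp only [B]; omega
      · simp only [B]; omega
      · simp only [length_encodeTally, VotingRule.winner, B]; omega
      · simp only [hsum, true_and, length_encodeTally, VotingRule.winner, Fin.ext_iff]
        omega
  · rintro ⟨P, t, c⟩
    constructor
    · rintro ⟨x, -, hsum, hr⟩
      exact ⟨profileOfCounts vs x, by rw [length_profileOfCounts, hsum],
        (hanon m hm _ _ List.perm_append_comm).trans hr⟩
    · rintro ⟨P', hP', hr⟩
      have hperm := profileOfCounts_count_perm P'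
      -- No ballot occurs more than `t` times, so the counts lie below the search bound `t + 1`.
      refine ⟨fun v => P'.count v, fun v => Nat.lt_succ_of_le (hP' ▸ List.count_le_length), ?_, ?_⟩
      · rw [← length_profileOfCounts, ← hP']
        exact hperm.length_eq
      · rw [← hr]
        exact hanon m hm _ _ ((hperm.append_right P).trans List.perm_append_comm)

/-! ### A fixed number of absent votes -/

section FixedT

variable {V : Type} [DecidableEq V]

/-- The encoding of a ballot from the numbers of the ranked candidates. -/
def encodeRanking (l : List ℕ) : List Γ' := Γ'.bra :: l.flatMap encodeTally ++ [Γ'.ket]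

theorem encodeProfile_eq {m : ℕ} (P : Profile m L) :
    encodeProfile P = (P.map fun b => b.ranking.map Fin.val).flatMap encodeRanking := by
  rw [encodeProfile, List.flatMap_map]
  congr 1
  funext b
  rw [encodeBallot, encodeRanking, List.flatMap_map]

theorem length_encodeRanking_le {l : List ℕ} {N : ℕ} (hl : ∀ n ∈ l, n ≤ N) :
    (encodeRanking l).length ≤ l.length * (N + 1) + 2 := by
  have := List.sum_le_card_nsmul (l.map fun n => n + 1) (N + 1) (by
    intro k hk
    obtain ⟨n, hn, rfl⟩ := List.mem_map.1 hk
    have := hl n hn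
    omega)
  simpa [encodeRanking, List.length_flatMap, length_encodeTally] using this

/-- Write the election with the absent votes whose ranked candidates are given by counters. -/
def assembleRankings (sh : List (List V)) : Prog (Reg ⊕ V) :=
  .seq (.seq (copy (.inl .bound) (.inl .arg) (.inl .tmp)) (pushAll (.inl .arg) [Γ'.comma]))
    (.seq (seqAll (sh.map fun vs => .seq (pushAll (.inl .arg) [Γ'.bra])
        (.seq (seqAll (vs.map fun v => .seq (copy (.inr v) (.inl .arg) (.inl .tmp))
          (pushAll (.inl .arg) [Γ'.comma]))) (pushAll (.inl .arg) [Γ'.ket]))))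
      (copy (.inl .inp) (.inl .arg) (.inl .tmp)))

theorem runsIn_assembleRankings {O : TM2ComputableAux Γ' Γ'} (sh : List (List V)) (M : Mem V)
    (hx : ∀ v, M.counter v ≤ M.bound) {K : ℕ} (hK : ∀ vs ∈ sh, vs.length ≤ K) :
    RunsIn O (assembleRankings sh) M.store (update M.store (.inl .arg)
      (encodeTally M.bound ++ (sh.map (·.map M.counter)).flatMap encodeRanking ++ M.inp).reverse)
      (sh.length * (K * (7 * M.bound + 4) + 5) + 7 * M.bound + 7 * M.inp.length + 10) := by
  have h1 : ∀ vs ∈ sh, Appends O M .arg (.seq (pushAll (.inl .arg) [Γ'.bra])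
        (.seq (seqAll (vs.map fun v => .seq (copy (.inr v) (.inl .arg) (.inl .tmp))
          (pushAll (.inl .arg) [Γ'.comma]))) (pushAll (.inl .arg) [Γ'.ket])))
      (encodeRanking (vs.map M.counter)) (K * (7 * M.bound + 4) + 5) := by
    intro vs hvs
    have h : Appends O M .arg (seqAll (vs.map fun v =>
        .seq (copy (.inr v) (.inl .arg) (.inl .tmp)) (pushAll (.inl .arg) [Γ'.comma])))
        (vs.flatMap fun v => encodeTally (M.counter v)) (vs.length * (7 * M.bound + 4) + 1) :=
      Appends.seqAll vs fun v _ => ((appends_copy (j := .inr v) (by simp) (by simp)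
        (by simp)).seq (appends_pushAll [Γ'.comma])).mono (by
          have := hx v
          simp [Mem.store]; omega)
    have := (appends_pushAll (O := O) (m := M) (k := .arg) [Γ'.bra]).seq
      (h.seq (appends_pushAll [Γ'.ket]))
    rw [encodeRanking, List.flatMap_map]
    refine Appends.mono this ?_
    have := Nat.mul_le_mul_right (7 * M.bound + 4) (hK vs hvs)
    simp
    omega
  have h2 := (((appends_copy (O := O) (m := M) (k := .arg) (j := .inl .bound) (by simp) (by simp)
    (by simp)).seq (appends_pushAll [Γ'.comma])).seq ((Appends.seqAll sh h1).seq
      (appends_copy (j := .inl .inp) (by simp) (by simp) (by simp)))).runsIn rfl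
  refine h2.congr_right ?_ ?_
  · simp [Mem.store, encodeTally, List.flatMap_map]
  · simp [Mem.store]
    omega

/-- Lists of distinct numbers of candidates, of admissible lengths, come from a profile. -/
theorem exists_profile {m : ℕ} (ls : List (List ℕ))
    (h : ∀ l ∈ ls, l.Nodup ∧ 1 ≤ l.length ∧ l.length ≤ L ∧ ∀ n ∈ l, n < m) :
    ∃ P : Profile m L, (P.map fun b => b.ranking.map Fin.val) = ls := by
  induction ls with
  | nil => exact ⟨[], rfl⟩
  | cons l ls ih =>
    obtain ⟨P, hP⟩ := ih fun l' hl' => h l' (by simp [hl'])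
    obtain ⟨hd, h1, h2, hlt⟩ := h l (by simp)
    obtain ⟨l', rfl⟩ : ∃ l' : List (Fin m), l'.map Fin.val = l :=
      ⟨l.pmap Fin.mk hlt, by simp [List.map_pmap]⟩
    exact ⟨⟨l', hd.of_map _, by simpa using h1, by simpa using h2⟩ :: P, by simp [hP]⟩

/-- Hence the counters determine the profile, and testing the one assembled profile decides the
existential statement `Q` in `wav_fixed_t`. -/
theorem rankings_injective {m : ℕ} :
    Injective fun P : Profile m L => P.map fun b => b.ranking.map Fin.val :=
  List.map_injective_iff.2 fun _ _ h =>
    Ballot.ranking_injective (List.map_injective_iff.2 Fin.val_injective h)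

variable {t : ℕ}

/-- The counters that form the ballots when the `j`-th absent voter ranks `len j + 1` candidates. -/
def slots (len : Fin t → Fin L) : List (List (Fin t × Fin L)) :=
  (List.finRange t).map fun j => ((List.finRange L).take (len j + 1)).map (Prod.mk j)

theorem nodup_of_mem_slots {len : Fin t → Fin L} {vs : List (Fin t × Fin L)}
    (h : vs ∈ slots len) : vs.Nodup := by
  obtain ⟨j, -, rfl⟩ := List.mem_map.1 h
  exact ((List.nodup_finRange L).sublist (List.take_sublist _ _)).map (Prod.mk_right_injective j)

theorem length_of_mem_slots {len : Fin t → Fin L} {vs : List (Fin t × Fin L)}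
    (h : vs ∈ slots len) : 1 ≤ vs.length ∧ vs.length ≤ L := by
  obtain ⟨j, -, rfl⟩ := List.mem_map.1 h
  have := (len j).isLt
  simp

theorem length_slots (len : Fin t → Fin L) : (slots len).length = t := by simp [slots]

/-- Counters beyond the length of a ballot are irrelevant; they are set to 0, which is a legal value
because `0 < m`. -/
theorem exists_slots {m : ℕ} (hm : 0 < m) (P : Profile m L) (hP : P.length = t) :
    ∃ (len : Fin t → Fin L) (x : Fin t × Fin L → ℕ), (∀ v, x v < m) ∧
      (P.map fun b => b.ranking.map Fin.val) = (slots len).map (·.map x) := by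
  subst hP
  refine ⟨fun j => ⟨(P.get j).ranking.length - 1, by
      have := (P.get j).one_le_length
      have := (P.get j).length_le
      omega⟩,
    fun v => if h : v.2 < (P.get v.1).ranking.length then ((P.get v.1).ranking[v.2.val]'h : ℕ)
      else 0, fun v => ?_, ?_⟩
  · dsimp only
    split_ifs
    · exact Fin.isLt _
    · exact hm
  · refine List.ext_getElem (by simp [slots]) fun j h1 h2 => ?_
    have hj : j < P.length := by simpa using h1
    have h1' := (P[j]).one_le_length
    have h2' := (P[j]).length_le
    refine List.ext_getElem (by simp [slots]; omega) fun i h3 h4 => ?_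
    have hi : i < (P[j]).ranking.length := by simpa using h3
    simp [slots, hi]

end FixedT

theorem wav_fixed_t {r : VotingRule L} (hanon : r.Anonymous) (hpoly : r.PolyTime) (t : ℕ) :
    PolyTimeDecidable (encodeFixedT (L := L) (t := t)) (fun I => r.WAV I.1) := by
  classical
  obtain ⟨M⟩ := hpoly
  let α := {I : WAVInstance L // I.absent = t}
  set size : α → ℕ := fun a => (encodeFixedT a).length with hsize
  have hp : PolyBound size fun a => a.1.m :=
    .of_le fun a => by simp [hsize, encodeFixedT, length_encodeTally]; omega
  have hw : PolyBound size fun a => (encodeProfile a.1.known).length :=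
    .of_le fun a => by simp [hsize, encodeFixedT]; omega
  let lens : List (Fin t → Fin L) := Finset.univ.toList
  -- A constant that bounds the number of comparisons for every choice of lengths at once.
  let D := (lens.map fun len => (distinctPairs (slots len)).length).sum
  let W : α → ℕ := fun a => a.1.m + 1 + (t * (L * (a.1.m + 1) + 2)) +
    (encodeProfile a.1.known).length
  have hW : PolyBound size W := by
    repeat' first
      | exact PolyBound.const _
      | exact hp
      | exact hw
      | apply PolyBound.add
      | apply PolyBound.mul
  let B : α → ℕ := fun a => (D * (25 * a.1.m + 10) + 1) +
    (t * (L * (7 * a.1.m + 4) + 5) + 7 * a.1.m + 7 * (encodeProfile a.1.known).length + 10) +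
      W a + M.time.eval (W a)
  have hB : PolyBound size B := by
    refine PolyBound.add (PolyBound.add (PolyBound.add ?_ ?_) hW) (hW.eval M.time)
    all_goals
      repeat' first
        | exact PolyBound.const _
        | exact hp
        | exact hw
        | apply PolyBound.add
        | apply PolyBound.mul
  let Q : α → (Fin t × Fin L → ℕ) → (Fin t → Fin L) → Prop := fun a x len =>
    ∃ P' : Profile a.1.m L, (P'.map fun b => b.ranking.map Fin.val) = (slots len).map (·.map x) ∧
      r a.1.m a.1.target.pos (P' ++ a.1.known) = a.1.target
  refine PolyTimeDecidable.congr (polyTimeDecidable_exists (O := M.toTM2ComputableAux)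
    (V := Fin t × Fin L) (p := fun a => a.1.m) (c := fun a => a.1.target)
    (w := fun a => encodeProfile a.1.known) (k := 0)
    (B := fun a => lens.length * (23 * B a + 13) + 1)
    (q := seqAll (lens.map fun len =>
      guarded (checkDistinct (slots len)) (assembleRankings (slots len))))
    (Q := fun a x => ∃ len ∈ lens, Q a x len)
    (fun a => rfl) (fun a => a.1.target.pos)
    (((PolyBound.const _).mul (((PolyBound.const 23).mul hB).add (.const 13))).add (.const 1))
    ?_) ?_
  · intro a x f hx
    have hx' : ∀ v, x v ≤ a.1.m := fun v => (hx v).le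
    refine (runsIn_seqAll_flag (Q := Q a x) lens
      ⟨encodeProfile a.1.known, a.1.m, a.1.target + 1, x, f⟩ ?_).congr_right (by congr!) le_rfl
    intro len hlen b
    have hD : (distinctPairs (slots len)).length ≤ D :=
      List.single_le_sum (by simp) _ (List.mem_map_of_mem hlen)
    obtain ⟨e, he, hel, hrun⟩ := runsIn_checkDistinct (O := M.toTM2ComputableAux)
      ⟨encodeProfile a.1.known, a.1.m, a.1.target + 1, x, b⟩ (slots len)
      (fun vs hvs => nodup_of_mem_slots hvs) hx'
    have hDm := Nat.mul_le_mul_right (25 * a.1.m + 10) hD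
    refine runsIn_guarded (B := B a)
      ⟨encodeProfile a.1.known, a.1.m, a.1.target + 1, x, b⟩ (hrun.mono ?_) (hel.trans ?_) ?_ ?_ ?_
    · simp only [B]; omega
    · have := Nat.le_mul_of_pos_right D (show 0 < 25 * a.1.m + 10 by omega)
      simp only [B]; omega
    · have := a.1.target.isLt
      simp only [B, W]; omega
    -- An error means that some absent vote would rank a candidate twice, which no ballot does.
    · rintro hne ⟨P', hP', -⟩
      refine hne (he.2 fun vs hvs => ?_)
      have : vs.map x ∈ (slots len).map (·.map x) := List.mem_map_of_mem hvs
      rw [← hP'] at this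
      obtain ⟨v, -, hv⟩ := List.mem_map.1 this
      change (vs.map x).Nodup
      rw [← hv]
      exact v.nodup.map Fin.val_injective
    · intro h0
      obtain ⟨P', hP'⟩ := exists_profile (L := L) (m := a.1.m) ((slots len).map (·.map x)) (by
        intro l hl
        obtain ⟨vs, hvs, rfl⟩ := List.mem_map.1 hl
        refine ⟨he.1 h0 vs hvs, by simpa using (length_of_mem_slots hvs).1,
          by simpa using (length_of_mem_slots hvs).2, fun n hn => ?_⟩
        obtain ⟨v, -, rfl⟩ := List.mem_map.1 hn
        exact hx v)
      have hwin := (r a.1.m a.1.target.pos (P' ++ a.1.known)).isLt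
      have hElen : (encodeElection ⟨a.1.m, a.1.target.pos, P' ++ a.1.known⟩).length ≤ W a := by
        have h1 : (encodeProfile P').length ≤ t * (L * (a.1.m + 1) + 2) := by
          rw [encodeProfile_eq, hP', List.length_flatMap]
          have := List.sum_le_card_nsmul (((slots len).map (·.map x)).map
            fun l => (encodeRanking l).length) (L * (a.1.m + 1) + 2) (by
            intro n hn
            obtain ⟨l, hl, rfl⟩ := List.mem_map.1 hn
            obtain ⟨vs, hvs, rfl⟩ := List.mem_map.1 hl
            refine (length_encodeRanking_le (N := a.1.m) ?_).trans ?_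
            · intro n hn
              obtain ⟨v, -, rfl⟩ := List.mem_map.1 hn
              exact hx' v
            · have := (length_of_mem_slots hvs).2
              simp only [List.length_map]
              gcongr)
          simpa [length_slots] using this
        simp only [encodeElection, encodeProfile, List.flatMap_append, List.length_append,
          length_encodeTally, W] at h1 ⊢
        omega
      obtain ⟨n, hn, hans⟩ := exists_answers M ⟨a.1.m, a.1.target.pos, P' ++ a.1.known⟩
      have hn' : n ≤ M.time.eval (W a) := hn.trans (eval_mono_nat M.time hElen)
      refine ⟨_, _, n, ((runsIn_assembleRankings (slots len)
        ⟨encodeProfile a.1.known, a.1.m, a.1.target + 1, x, b⟩ hx'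
        fun vs hvs => (length_of_mem_slots hvs).2).congr_right ?_ ?_),
        hans, hElen.trans ?_, hn'.trans ?_, ?_, ?_⟩
      · rw [← hP', ← encodeProfile_eq, encodeElection]
        simp only [encodeProfile, List.flatMap_append, List.append_assoc]
      · simp only [B, length_slots]; omega
      · simp only [B]; omega
      · simp only [B]; omega
      · simp only [length_encodeTally, VotingRule.winner, B, W]; omega
      · simp only [length_encodeTally, VotingRule.winner, Q]
        constructor
        · rintro ⟨P'', hP'', hr⟩
          obtain rfl : P'' = P' := rankings_injective (hP''.trans hP'.symm)
          rw [hr]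
        · intro h
          exact ⟨P', hP', Fin.ext (by omega)⟩
  · rintro ⟨I, rfl⟩
    constructor
    -- Anonymity is needed here only to exchange the absent votes, which are written first, with the
    -- known ones.
    · rintro ⟨x, -, len, -, P', hP', hr⟩
      refine ⟨P', ?_, (hanon _ _ _ _ List.perm_append_comm).trans hr⟩
      simpa [length_slots] using congrArg List.length hP'
    · rintro ⟨P', hP', hr⟩
      obtain ⟨len, x, hx, h⟩ := exists_slots I.target.pos P' hP'
      exact ⟨x, hx, len, by simp [lens], P', h, (hanon _ _ _ _ List.perm_append_comm).trans hr⟩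

end UpToL

theorem proposition2 (L : ℕ) (hL : 2 ≤ L) (r : UpToL.VotingRule L)
    (hanon : r.Anonymous) (hpoly : r.PolyTime) :
    (∀ m : ℕ, 2 ≤ m →
      UpToL.PolyTimeDecidable (UpToL.encodeFixedM (L := L) (m := m)) (fun I => r.WAV I.1)) ∧
    (∀ t : ℕ,
      UpToL.PolyTimeDecidable (UpToL.encodeFixedT (L := L) (t := t)) (fun I => r.WAV I.1)) := by
  refine ⟨fun m hm => ?_, fun t => UpToL.wav_fixed_t hanon hpoly t⟩
  -- Instances with `I.m = m` are transported to profiles over `Fin m`; the strings do not change.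
  refine (UpToL.wav_fixed_m hanon hpoly m (by omega)).comap
    (fun I => (I.2 ▸ I.1.known, I.1.absent, Fin.cast I.2 I.1.target)) ?_ ?_
  · rintro ⟨I, rfl⟩
    rfl
  · rintro ⟨I, rfl⟩
    exact Iff.rfl
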